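/- **Theorem 4.1 (privacy of DP-SVRG).** *Setting.* Let $C\subseteq\mathbb{R}^p$ be closed and convex, let $\mathcal{X}$ be a data universe, and let $f:\mathbb{R}^p\times\mathcal{X}\to\mathbb{R}$ be a loss such that for every $z\in\mathcal{X}$ the function $f(\cdot,z)$ is differentiable at each point of $C$ and, on $C$, is convex, $G$-Lipschitz and $L$-smooth (that is, $\|\nabla f(x,z)-\nabla f(y,z)\|_2\le L\|x-y\|_2$ for $x,y\in C$). Let $r:\mathbb{R}^p\to\mathbb{R}$ be convex. For a dataset $D=(z_1,\dots,z_n)\in\mathcal{X}^n$ put $F(x,D)=\frac1n\sum_{i=1}^n f(x,z_i)$, and suppose that for every $D$ the function $F(\cdot,D)+r$ is $\mu$-strongly convex on $C$, where $\mu>0$. Let $\tilde x_0\in C$, let $\eta>0$ be a step size, let $n,T,m\ge 1$ be integers and let $\sigma\ge 0$. Write $\mathrm{prox}_{\eta r}(y)=\arg\min_{x\in C}\{\frac12\|x-y\|_2^2+\eta r(x)\}$. *Algorithm.* On input $D$, DP-SVRG does the following for $s=1,\dots,T$. It sets $x_0^s=\tilde x_{s-1}$. For $t=1,\dots,m$ it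 draws an index $i_t^s$ uniformly from $\{1,\dots,n\}$ and a noise vector $u_t^s\sim\mathcal{N}(0,\sigma^2I_p)$ (all these draws being independent), and sets $$v_t^s=\nabla f(x_{t-1}^s,z_{i_t^s})-\nabla f(\tilde x_{s-1},z_{i_t^s})+\nabla F(\tilde x_{s-1},D)+u_t^s,\qquad x_t^s=\mathrm{prox}_{\eta r}(x_{t-1}^s-\eta v_t^s).$$ It then sets $\tilde x_s=\frac1m\sum_{k=1}^m x_k^s$. It returns $\tilde x_T$. *Privacy.* A randomized algorithm $\mathcal{A}$ is $(\varepsilon,\delta)$-differentially private if $\Pr(\mathcal{A}(D)\in S)\le e^{\varepsilon}\Pr(\mathcal{A}(D')\in S)+\delta$ for every measurable set $S$ of outputs and all datasets $D,D'\in\mathcal{X}^n$ that differ in only one entry. *Claim.* There are absolute constants $c_1,c>0$ such that, in this setting, for all $\varepsilon,\delta>0$ with $$\varepsilon\le c_1\frac{Tm}{n^2}\qquad\text{and}\qquad \varepsilon\le\ln(1/\delta),$$ DP-SVRG is $(\varepsilon,\delta)$-differentially private when $$\sigma^2=c\,\frac{G^2\,Tm\,\ln(1/\delta)}{n^2\varepsilon^2}.$$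 -/

import Mathlib

open MeasureTheory ProbabilityTheory

noncomputable section

namespace DPSVRG

universe u v

/-- Two datasets of `n` entries are neighbors if they differ by only one entry. -/
def Neighbors {n : ℕ} {Z : Type u} (D D' : Fin n → Z) : Prop :=
  ∃ i : Fin n, ∀ j : Fin n, j ≠ i → D j = D' j

/-- `(ε, δ)`-differential privacy of the randomized algorithm that draws its coins `ω` from `P`
and, on the dataset `D`, returns `A D ω`. -/
def IsDifferentiallyPrivate {n : ℕ} {Z : Type u} {Ω : Type v} {X : Type v}
    [MeasurableSpace Ω] [MeasurableSpace X]
    (P : Measure Ω) (A : (Fin n → Z) → Ω → X) (ε δ : ℝ) : Prop :=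
  ∀ D D' : Fin n → Z, Neighbors D D' → ∀ S : Set X, MeasurableSet S →
    P {ω | A D ω ∈ S} ≤ ENNReal.ofReal (Real.exp ε) * P {ω | A D' ω ∈ S} + ENNReal.ofReal δ

variable {p n : ℕ} {Z : Type u}

/-- The empirical risk `F(x, D) = (1/n) ∑ i, f(x, z_i)`. -/
def empRisk (f : EuclideanSpace ℝ (Fin p) → Z → ℝ) (D : Fin n → Z)
    (x : EuclideanSpace ℝ (Fin p)) : ℝ :=
  (1 / (n : ℝ)) * ∑ i, f x (D i)

/-- `x` is a minimizer over `C` of `(1/2) ‖x - y‖² + g x`. -/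
def IsProxPoint (C : Set (EuclideanSpace ℝ (Fin p))) (g : EuclideanSpace ℝ (Fin p) → ℝ)
    (y x : EuclideanSpace ℝ (Fin p)) : Prop :=
  x ∈ C ∧ ∀ w ∈ C, (1 / 2) * ‖x - y‖ ^ 2 + g x ≤ (1 / 2) * ‖w - y‖ ^ 2 + g w

/-- The proximal operator of `g` over `C`. For `g` convex on the whole space and `C` nonempty,
closed and convex, there is exactly one point to choose. -/
def prox (C : Set (EuclideanSpace ℝ (Fin p))) (g : EuclideanSpace ℝ (Fin p) → ℝ)
    (y : EuclideanSpace ℝ (Fin p)) : EuclideanSpace ℝ (Fin p) :=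
  Classical.epsilon (IsProxPoint C g y)

/-- One inner step from the point `x`, with reference point `xt`, sampled index `coin.1` and
Gaussian noise `coin.2`. -/
def innerStep (C : Set (EuclideanSpace ℝ (Fin p))) (f : EuclideanSpace ℝ (Fin p) → Z → ℝ)
    (r : EuclideanSpace ℝ (Fin p) → ℝ) (η : ℝ) (D : Fin n → Z)
    (xt x : EuclideanSpace ℝ (Fin p)) (coin : Fin n × EuclideanSpace ℝ (Fin p)) :
    EuclideanSpace ℝ (Fin p) :=
  prox C (fun w => η * r w)
    (x - η • (gradient (fun w => f w (D coin.1)) x - gradient (fun w => f w (D coin.1)) xt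
      + gradient (empRisk f D) xt + coin.2))

/-- The inner iterates `x_0, …, x_m` of one epoch, with `x_0 = xt`. -/
def innerIterate (C : Set (EuclideanSpace ℝ (Fin p))) (f : EuclideanSpace ℝ (Fin p) → Z → ℝ)
    (r : EuclideanSpace ℝ (Fin p) → ℝ) (η : ℝ) (D : Fin n → Z) (m : ℕ)
    (xt : EuclideanSpace ℝ (Fin p)) (coins : Fin m → Fin n × EuclideanSpace ℝ (Fin p))
    (t : Fin (m + 1)) : EuclideanSpace ℝ (Fin p) :=
  Fin.induction (motive := fun _ => EuclideanSpace ℝ (Fin p)) xt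
    (fun k x => innerStep C f r η D xt x (coins k)) t

/-- The result `(1/m) ∑_{k=1}^m x_k` of one epoch started at `xt`. -/
def epoch (C : Set (EuclideanSpace ℝ (Fin p))) (f : EuclideanSpace ℝ (Fin p) → Z → ℝ)
    (r : EuclideanSpace ℝ (Fin p) → ℝ) (η : ℝ) (D : Fin n → Z) (m : ℕ)
    (xt : EuclideanSpace ℝ (Fin p)) (coins : Fin m → Fin n × EuclideanSpace ℝ (Fin p)) :
    EuclideanSpace ℝ (Fin p) :=
  (1 / (m : ℝ)) • ∑ k : Fin m, innerIterate C f r η D m xt coins k.succ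

/-- The output `x̃_T` of DP-SVRG on the dataset `D` as a function of its coins: `ω s t` is the
index sampled and the noise vector added in inner step `t` of epoch `s`. -/
def svrg (C : Set (EuclideanSpace ℝ (Fin p))) (f : EuclideanSpace ℝ (Fin p) → Z → ℝ)
    (r : EuclideanSpace ℝ (Fin p) → ℝ) (x0 : EuclideanSpace ℝ (Fin p)) (T m : ℕ) (η : ℝ)
    (D : Fin n → Z) (ω : Fin T → Fin m → Fin n × EuclideanSpace ℝ (Fin p)) :
    EuclideanSpace ℝ (Fin p) :=
  Fin.induction (motive := fun _ => EuclideanSpace ℝ (Fin p)) x0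
    (fun s x => epoch C f r η D m x (ω s)) (Fin.last T)

/-- The Gaussian distribution `N(0, σ² I_p)`. -/
def isoGaussian (p : ℕ) (σ : ℝ) : Measure (EuclideanSpace ℝ (Fin p)) :=
  (Measure.pi fun _ : Fin p => gaussianReal 0 (Real.toNNReal (σ ^ 2))).map (WithLp.toLp 2)

/-- The law of the coins of DP-SVRG: all indices are uniform on the `n` entries, all noise vectors
are `N(0, σ² I_p)`, and all of them are independent. -/
def coinLaw (p n T m : ℕ) (σ : ℝ) :
    Measure (Fin T → Fin m → Fin n × EuclideanSpace ℝ (Fin p)) :=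
  Measure.pi fun _ => Measure.pi fun _ =>
    (uniformOn (Set.univ : Set (Fin n))).prod (isoGaussian p σ)

end DPSVRG

end

noncomputable section

namespace DPSVRG

universe u

open scoped ENNReal

/-! The proof is Rényi accounting for a subsampled Gaussian mechanism, applied to every inner step
and composed over all `T * m` of them, the intermediate iterates being treated as if they were
released.

Divergences are handled through their Hölder dual `HolderDominated`, where post-processing is `map`
and adaptive composition is `bind`, with no densities of the composed laws. The price of a change of
intermediate measure is a doubling of the order (`chain`).

Fix the current state. The noisy gradient estimate is a uniform mixture of Gaussians centred at the
drifts. For datasets that differ at entry `j`, the full gradient moves every centre by one vector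
`w` of norm at most `2G/n`, and centre `j` moves by a further `4G` at most. The common shift costs
`k ‖w‖² / (2σ²)`. The extra move has mixture weight `1/n`; the first-order terms vanish because both
densities integrate to 1, so its cost is quadratic in that weight (`holderDominated_gaussianMix`).
Both costs are of order `k G² / (n² σ²)`, as `holderDominated_noisyLaw` records, and
`holderDominated_model` multiplies the exponent by `T * m`. Taking the order comparable to `log
(1/δ) / ε` turns this into the claim (`HolderDominated.measure_le`, `exists_order`).

One geometric point remains. Lipschitz continuity on `C` bounds only the component of the gradient
along `vectorSpan ℝ C`, since `C` may be lower dimensional. The proximal map into `C` does not see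
the orthogonal component, so the algorithm is unchanged when gradients are projected (`svrg_eq`),
and the projected gradients are bounded by `G`. -/

/-- The dual form of a bound `log A` on `k / (k + 1)` times the Rényi divergence of order `k + 1`
of `μ` from `ν`. -/
def HolderDominated {X : Type*} [MeasurableSpace X] (k : ℕ) (A : ℝ≥0∞) (μ ν : Measure X) : Prop :=
  ∀ h : X → ℝ≥0∞, Measurable h →
    ∫⁻ x, h x ∂μ ≤ A * (∫⁻ x, h x ^ (((k : ℝ) + 1) / k) ∂ν) ^ ((k : ℝ) / (k + 1))

/-! ### Calculus of the dual Rényi bound. -/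

namespace HolderDominated

variable {X Y : Type*} [MeasurableSpace X] [MeasurableSpace Y] {k : ℕ} {A B : ℝ≥0∞}
  {μ ν : Measure X}

theorem exponent_mul_cancel (hk : 0 < k) : ((k : ℝ) / (k + 1)) * (((k : ℝ) + 1) / k) = 1 := by
  have : (0 : ℝ) < k := by exact_mod_cast hk
  field_simp

theorem mono (h : HolderDominated k A μ ν) (hAB : A ≤ B) : HolderDominated k B μ ν :=
  fun g hg => (h g hg).trans (mul_le_mul_left hAB _)

theorem map {f : X → Y} (hf : Measurable f) (h : HolderDominated k A μ ν) :
    HolderDominated k A (μ.map f) (ν.map f) := by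
  intro g hg
  rw [lintegral_map hg hf, lintegral_map (hg.pow_const _) hf]
  exact h _ (hg.comp hf)

theorem refl (hk : 0 < k) (μ : Measure X) [IsProbabilityMeasure μ] :
    HolderDominated k 1 μ μ := by
  intro g hg
  have hk' : (0 : ℝ) < k := by exact_mod_cast hk
  have hpq : (((k : ℝ) + 1) / k).HolderConjugate ((k : ℝ) + 1) := by
    rw [Real.holderConjugate_iff]
    refine ⟨by rw [lt_div_iff₀ hk']; linarith, by field_simp⟩
  have := ENNReal.lintegral_mul_le_Lp_mul_Lq μ hpq hg.aemeasurable
    (aemeasurable_const (b := (1 : ℝ≥0∞)))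
  simpa using this

/-- Weak triangle inequality. The dual exponents multiply as `(2k+2)/(2k+1) * (2k+1)/(2k) =
(k+1)/k`, which dictates the orders on the two legs; `1 ≤ B` allows the outer power of `B` to be
dropped. -/
theorem chain (hk : 0 < k) {ρ : Measure X} (h₁ : HolderDominated (2 * k + 1) A μ ρ)
    (h₂ : HolderDominated (2 * k) B ρ ν) (hB : 1 ≤ B) : HolderDominated k (A * B) μ ν := by
  intro g hg
  have hk' : (0 : ℝ) < k := by exact_mod_cast hk
  refine (h₁ g hg).trans ?_
  have h := h₂ _ (hg.pow_const ((((2 * k + 1 : ℕ) : ℝ) + 1) / ((2 * k + 1 : ℕ) : ℝ)))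
  have e₁ : ∀ x, (g x ^ ((((2 * k + 1 : ℕ) : ℝ) + 1) / ((2 * k + 1 : ℕ) : ℝ))) ^
      ((((2 * k : ℕ) : ℝ) + 1) / ((2 * k : ℕ) : ℝ)) = g x ^ (((k : ℝ) + 1) / k) := by
    intro x
    rw [← ENNReal.rpow_mul]
    congr 1
    push_cast
    field_simp
    ring
  simp only [e₁] at h
  calc _ ≤ A * (B * (∫⁻ x, g x ^ (((k : ℝ) + 1) / k) ∂ν) ^
        (((2 * k : ℕ) : ℝ) / (((2 * k : ℕ) : ℝ) + 1))) ^
        (((2 * k + 1 : ℕ) : ℝ) / (((2 * k + 1 : ℕ) : ℝ) + 1)) := by gcongr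
    _ = A * (B ^ (((2 * k + 1 : ℕ) : ℝ) / (((2 * k + 1 : ℕ) : ℝ) + 1)) *
        (∫⁻ x, g x ^ (((k : ℝ) + 1) / k) ∂ν) ^ ((k : ℝ) / (k + 1))) := by
      rw [ENNReal.mul_rpow_of_nonneg _ _ (by positivity), ← ENNReal.rpow_mul]
      congr 3
      push_cast
      field_simp
      ring
    _ ≤ A * (B * (∫⁻ x, g x ^ (((k : ℝ) + 1) / k) ∂ν) ^ ((k : ℝ) / (k + 1))) := by
      gcongr
      conv_rhs => rw [← ENNReal.rpow_one B]
      refine ENNReal.rpow_le_rpow_of_exponent_le hB ?_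
      rw [div_le_one (by positivity)]
      linarith
    _ = _ := by rw [mul_assoc]

/-- Adaptive composition. The inner bound is a function of `x` raised to `k/(k+1)`, and the outer
bound raises it to the reciprocal power, so the exponents cancel. With `μ = ν` and `A = 1` this is
joint quasi-convexity, the form used for mixtures. -/
theorem bind (hk : 0 < k) {κ κ' : X → Measure Y} (hκ : Measurable κ) (hκ' : Measurable κ')
    (h : HolderDominated k A μ ν) (hY : ∀ x, HolderDominated k B (κ x) (κ' x)) :
    HolderDominated k (A * B) (μ.bind κ) (ν.bind κ') := by
  intro g hg
  have hm : Measurable fun x => ∫⁻ y, g y ^ (((k : ℝ) + 1) / k) ∂κ' x :=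
    (Measure.measurable_lintegral (hg.pow_const _)).comp hκ'
  rw [Measure.lintegral_bind hκ.aemeasurable hg.aemeasurable,
    Measure.lintegral_bind hκ'.aemeasurable (hg.pow_const _).aemeasurable]
  calc ∫⁻ x, ∫⁻ y, g y ∂κ x ∂μ
      ≤ ∫⁻ x, B * (∫⁻ y, g y ^ (((k : ℝ) + 1) / k) ∂κ' x) ^ ((k : ℝ) / (k + 1)) ∂μ :=
        lintegral_mono fun x => hY x g hg
    _ = B * ∫⁻ x, (∫⁻ y, g y ^ (((k : ℝ) + 1) / k) ∂κ' x) ^ ((k : ℝ) / (k + 1)) ∂μ :=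
        lintegral_const_mul _ (hm.pow_const _)
    _ ≤ B * (A * (∫⁻ x, ((∫⁻ y, g y ^ (((k : ℝ) + 1) / k) ∂κ' x) ^ ((k : ℝ) / (k + 1))) ^
          (((k : ℝ) + 1) / k) ∂ν) ^ ((k : ℝ) / (k + 1))) := by
        gcongr
        exact h _ (hm.pow_const _)
    _ = _ := by
        simp only [← ENNReal.rpow_mul, exponent_mul_cancel hk, ENNReal.rpow_one]
        ring

/-- Hölder with exponents `k+1` and `(k+1)/k`, after writing `f = (f / g^a) * g^a` with `a =
k/(k+1)`. The integral bounded by `M` is the Rényi moment of order `k+1`. -/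
theorem of_density {η : Measure X} {f g : X → ℝ} (hk : 0 < k) (hf : Measurable f)
    (hg : Measurable g) (hf0 : ∀ x, 0 ≤ f x) (hg0 : ∀ x, 0 < g x) {M : ℝ≥0∞}
    (hM : ∫⁻ x, ENNReal.ofReal (f x ^ (k + 1) / g x ^ k) ∂η ≤ M) :
    HolderDominated k (M ^ (1 / ((k : ℝ) + 1))) (η.withDensity fun x => ENNReal.ofReal (f x))
      (η.withDensity fun x => ENNReal.ofReal (g x)) := by
  intro h hh
  have hk' : (0 : ℝ) < k := by exact_mod_cast hk
  have hpq : ((k : ℝ) + 1).HolderConjugate (((k : ℝ) + 1) / k) := by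
    rw [Real.holderConjugate_iff]
    refine ⟨by linarith, by field_simp; ring⟩
  set a : ℝ := (k : ℝ) / (k + 1) with ha
  have ha0 : 0 < a := by positivity
  have key : ∀ x, ENNReal.ofReal (f x) * h x =
      ENNReal.ofReal (f x / g x ^ a) * (ENNReal.ofReal (g x ^ a) * h x) := by
    intro x
    have := Real.rpow_pos_of_pos (hg0 x) a
    rw [← mul_assoc, ← ENNReal.ofReal_mul (div_nonneg (hf0 x) this.le), div_mul_cancel₀ _ this.ne']
  rw [lintegral_withDensity_eq_lintegral_mul _ hf.ennreal_ofReal hh,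
    lintegral_withDensity_eq_lintegral_mul _ hg.ennreal_ofReal (hh.pow_const _)]
  simp only [Pi.mul_apply, key]
  refine (ENNReal.lintegral_mul_le_Lp_mul_Lq η hpq
    (hf.div (hg.pow_const _)).ennreal_ofReal.aemeasurable
    (((hg.pow_const _).ennreal_ofReal.mul hh).aemeasurable)).trans ?_
  have hinv : 1 / (((k : ℝ) + 1) / k) = a := by rw [ha, one_div_div]
  rw [hinv]
  refine mul_le_mul' (ENNReal.rpow_le_rpow ?_ (by positivity))
    (ENNReal.rpow_le_rpow (lintegral_mono fun x => le_of_eq ?_) ha0.le)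
  · refine le_trans (le_of_eq (lintegral_congr fun x => ?_)) hM
    have hgx := Real.rpow_pos_of_pos (hg0 x) a
    rw [Pi.div_apply, ENNReal.ofReal_rpow_of_nonneg (div_nonneg (hf0 x) hgx.le) (by positivity),
      Real.div_rpow (hf0 x) hgx.le, ← Real.rpow_mul (hg0 x).le]
    congr 2
    · exact_mod_cast Real.rpow_natCast (f x) (k + 1)
    · rw [ha, div_mul_cancel₀ _ (by positivity), Real.rpow_natCast]
  · rw [Pi.mul_apply, ENNReal.mul_rpow_of_nonneg _ _ (by positivity),
      ENNReal.ofReal_rpow_of_nonneg (Real.rpow_nonneg (hg0 x).le _) (by positivity),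
      ← Real.rpow_mul (hg0 x).le, exponent_mul_cancel hk, Real.rpow_one]

end HolderDominated

/-! ### Iterated random maps driven by independent coins. -/

section Run

variable {S K : Type*} [MeasurableSpace S] [MeasurableSpace K]

/-- The state reached from `s` after `m` transitions driven by the coins `c`. -/
def run (Φ : S → K → S) (s : S) : (m : ℕ) → (Fin m → K) → S
  | 0, _ => s
  | m + 1, c => Φ (run Φ s m fun i => c i.castSucc) (c (Fin.last m))

theorem measurable_run {Φ : S → K → S} (hΦ : Measurable (Function.uncurry Φ)) (m : ℕ) :
    Measurable fun q : S × (Fin m → K) => run Φ q.1 m q.2 := by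
  induction m with
  | zero => exact measurable_fst
  | succ m ih =>
    have h1 : Measurable fun q : S × (Fin (m + 1) → K) =>
        run Φ q.1 m fun i => q.2 i.castSucc :=
      ih.comp (f := fun q : S × (Fin (m + 1) → K) =>
        (q.1, fun i : Fin m => q.2 i.castSucc)) (by fun_prop)
    exact hΦ.comp (h1.prodMk (by fun_prop : Measurable fun q : S × (Fin (m + 1) → K) =>
      q.2 (Fin.last m)))

theorem measurable_run_right {Φ : S → K → S} (hΦ : Measurable (Function.uncurry Φ)) (s : S)
    (m : ℕ) : Measurable (run Φ s m) :=
  (measurable_run hΦ m).comp measurable_prodMk_left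

theorem measurable_map_transition (P : Measure K) [SFinite P] {Φ : S → K → S}
    (hΦ : Measurable (Function.uncurry Φ)) : Measurable fun s => P.map (Φ s) := by
  refine Measure.measurable_of_measurable_coe _ fun t ht => ?_
  have : (fun s => P.map (Φ s) t) =
      fun s => P (Prod.mk s ⁻¹' (Function.uncurry Φ ⁻¹' t)) := by
    funext s
    exact Measure.map_apply (f := Φ s) (hΦ.comp measurable_prodMk_left) ht
  rw [this]
  exact measurable_measure_prodMk_left (hΦ ht)

/-- Markov property: the last coin is independent of the earlier ones, so it can be split off the
product measure. -/
theorem map_run_succ (P : Measure K) [IsProbabilityMeasure P] {Φ : S → K → S}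
    (hΦ : Measurable (Function.uncurry Φ)) (s : S) (m : ℕ) :
    (Measure.pi fun _ : Fin (m + 1) => P).map (run Φ s (m + 1)) =
      ((Measure.pi fun _ : Fin m => P).map (run Φ s m)).bind fun x => P.map (Φ x) := by
  have hrun := measurable_run_right hΦ s
  have hmp := measurePreserving_piFinSuccAbove (fun _ : Fin (m + 1) => P) (Fin.last m)
  refine Measure.ext_of_lintegral _ fun g hg => ?_
  rw [Measure.lintegral_bind (measurable_map_transition P hΦ).aemeasurable hg.aemeasurable,
    lintegral_map hg (hrun _), lintegral_map _ (hrun _)]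
  · have hG : Measurable fun q : K × (Fin m → K) => g (Φ (run Φ s m q.2) q.1) :=
      hg.comp (hΦ.comp (((hrun m).comp measurable_snd).prodMk measurable_fst))
    have e : ∀ c : Fin (m + 1) → K, g (run Φ s (m + 1) c) =
        (fun q : K × (Fin m → K) => g (Φ (run Φ s m q.2) q.1))
          (MeasurableEquiv.piFinSuccAbove (fun _ => K) (Fin.last m) c) := by
      intro c
      simp only [MeasurableEquiv.piFinSuccAbove_apply, run, Fin.insertNthEquiv_symm_apply]
      congr 3
      funext i
      simp [Fin.removeNth]
    simp only [e]
    rw [hmp.lintegral_comp hG, lintegral_prod_symm' _ hG]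
    refine lintegral_congr fun c => ?_
    exact (lintegral_map (g := Φ (run Φ s m c)) hg (hΦ.comp measurable_prodMk_left)).symm
  · exact (Measure.measurable_lintegral hg).comp (measurable_map_transition P hΦ)

theorem HolderDominated.run (P : Measure K) [IsProbabilityMeasure P] {Φ Φ' : S → K → S}
    (hΦ : Measurable (Function.uncurry Φ)) (hΦ' : Measurable (Function.uncurry Φ'))
    {k : ℕ} (hk : 0 < k) {A : ℝ≥0∞} (h : ∀ s, HolderDominated k A (P.map (Φ s)) (P.map (Φ' s)))
    (s : S) (m : ℕ) :
    HolderDominated k (A ^ m) ((Measure.pi fun _ : Fin m => P).map (run Φ s m))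
      ((Measure.pi fun _ : Fin m => P).map (DPSVRG.run Φ' s m)) := by
  induction m with
  | zero =>
    have h0 : DPSVRG.run Φ s 0 = DPSVRG.run Φ' s 0 := rfl
    rw [pow_zero, h0]
    have : IsProbabilityMeasure ((Measure.pi fun _ : Fin 0 => P).map (DPSVRG.run Φ' s 0)) :=
      Measure.isProbabilityMeasure_map (measurable_run_right hΦ' s 0).aemeasurable
    exact HolderDominated.refl hk _
  | succ m ih =>
    rw [map_run_succ P hΦ, map_run_succ P hΦ', pow_succ]
    exact HolderDominated.bind hk (measurable_map_transition P hΦ)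
      (measurable_map_transition P hΦ') ih h

end Run

/-! ### Gaussian shifts and exponential moments. -/

section Gaussian

/-- The density of `N(a, σ² I)` with respect to `N(0, σ² I)`. -/
def tilt {p : ℕ} (σ : ℝ) (a x : EuclideanSpace ℝ (Fin p)) : ℝ :=
  Real.exp (inner ℝ a x / σ ^ 2 - ‖a‖ ^ 2 / (2 * σ ^ 2))

theorem tilt_pos {p : ℕ} (σ : ℝ) (a x : EuclideanSpace ℝ (Fin p)) : 0 < tilt σ a x :=
  Real.exp_pos _

theorem measurable_tilt {p : ℕ} (σ : ℝ) (a : EuclideanSpace ℝ (Fin p)) :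
    Measurable (tilt σ a) := by
  unfold tilt
  fun_prop

instance isProbabilityMeasure_isoGaussian (p : ℕ) (σ : ℝ) :
    IsProbabilityMeasure (isoGaussian p σ) := by
  unfold isoGaussian
  exact Measure.isProbabilityMeasure_map (by fun_prop)

theorem gaussianReal_eq_withDensity (a : ℝ) {σ : ℝ} (hσ : 0 < σ) :
    gaussianReal a (Real.toNNReal (σ ^ 2)) =
      (gaussianReal 0 (Real.toNNReal (σ ^ 2))).withDensity fun x =>
        ENNReal.ofReal (Real.exp (a * x / σ ^ 2 - a ^ 2 / (2 * σ ^ 2))) := by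
  have hv : Real.toNNReal (σ ^ 2) ≠ 0 := by
    simp only [ne_eq, Real.toNNReal_eq_zero, not_le]
    positivity
  rw [gaussianReal_of_var_ne_zero _ hv, gaussianReal_of_var_ne_zero _ hv,
    ← withDensity_mul _ (measurable_gaussianPDF _ _) (by fun_prop)]
  congr 1
  funext x
  rw [Pi.mul_apply, gaussianPDF, gaussianPDF, ← ENNReal.ofReal_mul (gaussianPDFReal_nonneg _ _ _)]
  congr 1
  rw [gaussianPDFReal, gaussianPDFReal, mul_assoc _ (Real.exp _) (Real.exp _), ← Real.exp_add,
    Real.coe_toNNReal _ (by positivity)]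
  congr 2
  field_simp
  ring

theorem pi_gaussianReal_eq_withDensity {p : ℕ} (a : Fin p → ℝ) {σ : ℝ} (hσ : 0 < σ) :
    (Measure.pi fun i => gaussianReal (a i) (Real.toNNReal (σ ^ 2))) =
      (Measure.pi fun _ : Fin p => gaussianReal 0 (Real.toNNReal (σ ^ 2))).withDensity fun x =>
        ENNReal.ofReal (∏ i, Real.exp (a i * x i / σ ^ 2 - a i ^ 2 / (2 * σ ^ 2))) := by
  refine Measure.pi_eq fun s hs => ?_
  have hint : ∀ i, Integrable (fun x => Real.exp (a i * x / σ ^ 2 - a i ^ 2 / (2 * σ ^ 2)))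
      ((gaussianReal 0 (Real.toNNReal (σ ^ 2))).restrict (s i)) := by
    intro i
    refine Integrable.restrict ?_
    have := (integrable_exp_mul_gaussianReal (μ := 0) (v := Real.toNNReal (σ ^ 2))
      (a i / σ ^ 2)).mul_const (Real.exp (- (a i ^ 2 / (2 * σ ^ 2))))
    refine this.congr (Filter.Eventually.of_forall fun x => ?_)
    simp only
    rw [← Real.exp_add]
    congr 1
    ring
  rw [withDensity_apply _ (MeasurableSet.univ_pi hs), Measure.restrict_pi_pi,
    ← ofReal_integral_eq_lintegral_ofReal (Integrable.fintype_prod_dep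
      (f := fun i x => Real.exp (a i * x / σ ^ 2 - a i ^ 2 / (2 * σ ^ 2))) hint)
      (Filter.Eventually.of_forall fun x => Finset.prod_nonneg fun i _ => (Real.exp_pos _).le),
    integral_fintype_prod_eq_prod (𝕜 := ℝ)
      (fun i x => Real.exp (a i * x / σ ^ 2 - a i ^ 2 / (2 * σ ^ 2))),
    ENNReal.ofReal_prod_of_nonneg fun i _ => integral_nonneg fun x => (Real.exp_pos _).le]
  refine Finset.prod_congr rfl fun i _ => ?_
  rw [gaussianReal_eq_withDensity (a i) hσ, withDensity_apply _ (hs i),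
    ofReal_integral_eq_lintegral_ofReal (hint i)
      (Filter.Eventually.of_forall fun x => (Real.exp_pos _).le)]

theorem isoGaussian_map_add {p : ℕ} {σ : ℝ} (hσ : 0 < σ) (a : EuclideanSpace ℝ (Fin p)) :
    (isoGaussian p σ).map (fun x => a + x) =
      (isoGaussian p σ).withDensity fun x => ENNReal.ofReal (tilt σ a x) := by
  have hmeas : Measurable (WithLp.toLp 2 : (Fin p → ℝ) → EuclideanSpace ℝ (Fin p)) := by fun_prop
  refine Measure.ext_of_lintegral _ fun g hg => ?_
  have hshift : Measure.pi (fun i => gaussianReal (a i) (Real.toNNReal (σ ^ 2))) =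
      (Measure.pi fun _ : Fin p => gaussianReal 0 (Real.toNNReal (σ ^ 2))).map
        (fun x i => a i + x i) := by
    rw [Measure.pi_map_pi (f := fun i x => a i + x) (fun i => by fun_prop)]
    congr 1
    funext i
    rw [gaussianReal_map_const_add, zero_add]
  rw [lintegral_withDensity_eq_lintegral_mul _ (measurable_tilt σ a).ennreal_ofReal hg,
    lintegral_map hg (by fun_prop), isoGaussian, lintegral_map (by fun_prop) hmeas,
    lintegral_map (((measurable_tilt σ a).ennreal_ofReal).mul hg) hmeas]
  have h1 : ∀ x : Fin p → ℝ, g (a + WithLp.toLp 2 x) = (fun y => g (WithLp.toLp 2 y))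
      ((fun (x : Fin p → ℝ) i => a i + x i) x) := by
    intro x
    rfl
  simp only [h1]
  rw [← lintegral_map (f := fun y => g (WithLp.toLp 2 y)) (by fun_prop) (by fun_prop), ← hshift,
    pi_gaussianReal_eq_withDensity _ hσ,
    lintegral_withDensity_eq_lintegral_mul _ (by fun_prop) (by fun_prop)]
  refine lintegral_congr fun x => ?_
  simp only [Pi.mul_apply]
  congr 2
  rw [tilt, ← Real.exp_sum, Finset.sum_sub_distrib, EuclideanSpace.norm_sq_eq,
    ← Finset.sum_div, ← Finset.sum_div]
  simp [PiLp.inner_apply, mul_comm]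

theorem lintegral_tilt {p : ℕ} {σ : ℝ} (hσ : 0 < σ) (a : EuclideanSpace ℝ (Fin p)) :
    ∫⁻ x, ENNReal.ofReal (tilt σ a x) ∂isoGaussian p σ = 1 := by
  have h := congrArg (fun μ => μ Set.univ) (isoGaussian_map_add hσ a)
  simp only [withDensity_apply _ MeasurableSet.univ, Measure.restrict_univ] at h
  rw [← h, Measure.map_apply (by fun_prop) MeasurableSet.univ]
  simp

theorem lintegral_exp_inner {p : ℕ} {σ : ℝ} (hσ : 0 < σ) (a : EuclideanSpace ℝ (Fin p)) :
    ∫⁻ x, ENNReal.ofReal (Real.exp (inner ℝ a x / σ ^ 2)) ∂isoGaussian p σ =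
      ENNReal.ofReal (Real.exp (‖a‖ ^ 2 / (2 * σ ^ 2))) := by
  have : ∀ x, ENNReal.ofReal (Real.exp (inner ℝ a x / σ ^ 2)) =
      ENNReal.ofReal (Real.exp (‖a‖ ^ 2 / (2 * σ ^ 2))) * ENNReal.ofReal (tilt σ a x) := by
    intro x
    rw [← ENNReal.ofReal_mul (Real.exp_pos _).le, tilt, ← Real.exp_add]
    congr 2
    ring
  simp only [this]
  rw [lintegral_const_mul _ (measurable_tilt σ a).ennreal_ofReal, lintegral_tilt hσ, mul_one]

theorem lintegral_exp_mul_gaussianReal (t : ℝ) :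
    ∫⁻ y, ENNReal.ofReal (Real.exp (t * y)) ∂gaussianReal 0 1 =
      ENNReal.ofReal (Real.exp (t ^ 2 / 2)) := by
  rw [← ofReal_integral_eq_lintegral_ofReal (integrable_exp_mul_gaussianReal t)
    (Filter.Eventually.of_forall fun x => (Real.exp_pos _).le)]
  have := congrFun (mgf_fun_id_gaussianReal (μ := 0) (v := 1)) t
  simp only [mgf] at this
  rw [this]
  simp

theorem lintegral_exp_sq_gaussianReal_le :
    ∫⁻ y, ENNReal.ofReal (Real.exp (y ^ 2 / 4)) ∂gaussianReal 0 1 ≤ 2 := by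
  rw [gaussianReal_of_var_ne_zero _ one_ne_zero,
    lintegral_withDensity_eq_lintegral_mul _ (measurable_gaussianPDF _ _) (by fun_prop)]
  have h : ∀ y, (gaussianPDF 0 1 * fun y => ENNReal.ofReal (Real.exp (y ^ 2 / 4))) y =
      ENNReal.ofReal ((√(2 * Real.pi))⁻¹ * Real.exp (-(1 / 4) * y ^ 2)) := by
    intro y
    rw [Pi.mul_apply, gaussianPDF, ← ENNReal.ofReal_mul (gaussianPDFReal_nonneg _ _ _),
      gaussianPDFReal, mul_assoc, ← Real.exp_add]
    simp only [NNReal.coe_one, mul_one, sub_zero]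
    congr 3
    ring
  simp only [h]
  rw [← ofReal_integral_eq_lintegral_ofReal
    ((integrable_exp_neg_mul_sq (by norm_num)).const_mul _)
    (Filter.Eventually.of_forall fun x => by positivity), integral_const_mul, integral_gaussian]
  rw [show (2 : ℝ≥0∞) = ENNReal.ofReal 2 by simp]
  refine ENNReal.ofReal_le_ofReal ?_
  rw [← Real.sqrt_inv, ← Real.sqrt_mul (by positivity)]
  refine Real.sqrt_le_iff.2 ⟨by norm_num, ?_⟩
  have := Real.pi_pos
  field_simp
  norm_num

/-- The square is linearized by an auxiliary standard Gaussian `y`: `exp (z²/4)` is the mean of `exp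
(z y / √2)`. After exchanging integrals the inner one is explicit and at most `exp (y²/4)`. -/
theorem lintegral_exp_sq_inner_le {p : ℕ} {σ : ℝ} (hσ : 0 < σ) (a : EuclideanSpace ℝ (Fin p))
    (ha : ‖a‖ ≤ σ) :
    ∫⁻ x, ENNReal.ofReal (Real.exp ((inner ℝ a x / σ ^ 2) ^ 2 / 4)) ∂isoGaussian p σ ≤ 2 := by
  have h2 : (√2 : ℝ) ^ 2 = 2 := Real.sq_sqrt (by norm_num)
  have e1 : ∀ x : EuclideanSpace ℝ (Fin p),
      ENNReal.ofReal (Real.exp ((inner ℝ a x / σ ^ 2) ^ 2 / 4)) =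
      ∫⁻ y, ENNReal.ofReal (Real.exp ((inner ℝ a x / σ ^ 2 / √2) * y)) ∂gaussianReal 0 1 := by
    intro x
    rw [lintegral_exp_mul_gaussianReal, div_pow _ (√2), h2]
    congr 2
    ring
  simp only [e1]
  rw [lintegral_lintegral_swap (by fun_prop)]
  refine (lintegral_mono fun y => ?_).trans lintegral_exp_sq_gaussianReal_le
  have e2 : ∀ x : EuclideanSpace ℝ (Fin p),
      (inner ℝ a x / σ ^ 2 / √2) * y = inner ℝ ((y / √2) • a) x / σ ^ 2 := by
    intro x
    rw [real_inner_smul_left]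
    ring
  simp only [e2]
  rw [lintegral_exp_inner hσ]
  refine ENNReal.ofReal_le_ofReal (Real.exp_le_exp.2 ?_)
  rw [norm_smul, mul_pow, Real.norm_eq_abs, sq_abs, div_pow, h2]
  have : ‖a‖ ^ 2 ≤ σ ^ 2 := by gcongr
  rw [div_le_iff₀ (by positivity)]
  nlinarith [sq_nonneg y]

end Gaussian

/-! ### Pointwise inequalities for the mixture density ratio. -/

section Scalar

/-- A second-order Taylor bound whose first-order term is exact, so that it can cancel after
integration. -/
theorem one_add_pow_le {y : ℝ} (hy : -1 ≤ y) (k : ℕ) :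
    (1 + y) ^ k ≤ 1 + k * y + k ^ 2 * y ^ 2 * max 1 ((1 + y) ^ k) := by
  induction k with
  | zero => simp
  | succ k ih =>
    have h1 : (1 + y) * max 1 ((1 + y) ^ k) ≤ max 1 ((1 + y) ^ (k + 1)) := by
      rcases le_total 0 y with h | h
      · have : 1 ≤ (1 + y) ^ k := one_le_pow₀ (by linarith)
        rw [max_eq_right this, pow_succ']
        exact le_max_right _ _
      · have : (1 + y) ^ k ≤ 1 := pow_le_one₀ (by linarith) (by linarith)
        rw [max_eq_left this]
        exact (by linarith : (1 + y) * 1 ≤ 1).trans (le_max_left _ _)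
    have h2 : (1 : ℝ) ≤ max 1 ((1 + y) ^ (k + 1)) := le_max_left _ _
    set W := max 1 ((1 + y) ^ k)
    set W' := max 1 ((1 + y) ^ (k + 1))
    have h3 : (1 + y) ^ (k + 1) ≤ (1 + y) * (1 + k * y + k ^ 2 * y ^ 2 * W) := by
      rw [pow_succ']
      exact mul_le_mul_of_nonneg_left ih (by linarith)
    have h4 : (k : ℝ) ^ 2 * y ^ 2 * ((1 + y) * W) ≤ k ^ 2 * y ^ 2 * W' :=
      mul_le_mul_of_nonneg_left h1 (by positivity)
    have h5 : (2 * k + 1) * y ^ 2 * 1 ≤ (2 * k + 1) * y ^ 2 * W' :=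
      mul_le_mul_of_nonneg_left h2 (by positivity)
    have h6 : 0 ≤ (k : ℝ) * y ^ 2 := by positivity
    have h7 : 0 ≤ y ^ 2 := by positivity
    push_cast
    nlinarith

/-- The linear term keeps its factor `q`; a plain bound by `exp |u|` would lose the gain from
subsampling once raised to the power `k+1`. -/
theorem mix_exp_le {q u : ℝ} (hq0 : 0 ≤ q) (hq : q ≤ 1 / 2) :
    1 - q + q * Real.exp u ≤ Real.exp (2 * q * |u| + u ^ 2) := by
  rcases le_total u 1 with h | h
  · rcases le_total 0 u with h0 | h0
    · have hb : Real.exp u ≤ 1 + 2 * u := by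
        have := Real.abs_exp_sub_one_sub_id_le (x := u) (by rw [abs_of_nonneg h0]; exact h)
        have := (abs_le.1 this).2
        nlinarith
      rw [abs_of_nonneg h0]
      have h1 : 1 - q + q * Real.exp u ≤ 1 + 2 * q * u := by nlinarith
      have h2 := Real.add_one_le_exp (2 * q * u + u ^ 2)
      nlinarith [sq_nonneg u]
    · have h1 : Real.exp u ≤ 1 := Real.exp_le_one_iff.2 h0
      have h2 : (1 : ℝ) ≤ Real.exp (2 * q * |u| + u ^ 2) := Real.one_le_exp (by positivity)
      nlinarith
  · have h1 : 1 ≤ Real.exp u := Real.one_le_exp (by linarith)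
    have h2 : Real.exp u ≤ Real.exp (2 * q * |u| + u ^ 2) := by
      refine Real.exp_le_exp.2 ?_
      have : 0 ≤ 2 * q * |u| := by positivity
      nlinarith
    nlinarith

theorem exp_le_mix_exp {q u : ℝ} (hq0 : 0 ≤ q) (hq : q ≤ 1 / 2) :
    Real.exp (-(q * |u|)) ≤ 1 - q + q * Real.exp u := by
  have h := convexOn_exp.2 (Set.mem_univ (0 : ℝ)) (Set.mem_univ u) (by linarith : 0 ≤ 1 - q) hq0
    (by ring)
  simp only [smul_eq_mul, mul_zero, zero_add, Real.exp_zero, mul_one] at h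
  refine le_trans (Real.exp_le_exp.2 ?_) h
  have := neg_abs_le u
  nlinarith

/-- With `r`, `r'` the two mixtures, expand `r' * (r/r')^(k+1)` around `r/r' = 1`; the factor 2 is
the bound on `1/r'`. The negative first-order term is moved to the left so that the inequality can
be integrated in `ℝ≥0∞`. -/
theorem mix_exp_pow_div_le {q u u' : ℝ} (hq0 : 0 ≤ q) (hq : q ≤ 1 / 2) (k : ℕ) :
    (1 - q + q * Real.exp u) ^ (k + 1) / (1 - q + q * Real.exp u') ^ k
        + (k + 1) * (1 - q + q * Real.exp u') ≤
      (1 - q + q * Real.exp u') + (k + 1) * (1 - q + q * Real.exp u)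
        + (k + 1) ^ 2 * q ^ 2 * (2 * (Real.exp u - Real.exp u') ^ 2 *
          Real.exp ((k + 1) * (2 * q * |u| + u ^ 2 + q * |u'|))) := by
  have hu := Real.exp_pos u
  have hu' := Real.exp_pos u'
  have hr : 0 < 1 - q + q * Real.exp u := by nlinarith [mul_nonneg hq0 hu.le]
  have hr' : 1 / 2 ≤ 1 - q + q * Real.exp u' := by nlinarith [mul_nonneg hq0 hu'.le]
  have hd : (1 - q + q * Real.exp u) - (1 - q + q * Real.exp u') =
    q * (Real.exp u - Real.exp u') := by ring
  have hE : (1 - q + q * Real.exp u) / (1 - q + q * Real.exp u') ≤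
      Real.exp (2 * q * |u| + u ^ 2 + q * |u'|) := by
    rw [div_le_iff₀ (by linarith)]
    calc _ ≤ Real.exp (2 * q * |u| + u ^ 2) := mix_exp_le hq0 hq
      _ = Real.exp (2 * q * |u| + u ^ 2 + q * |u'|) * Real.exp (-(q * |u'|)) := by
        rw [← Real.exp_add]; congr 1; ring
      _ ≤ _ := by gcongr; exact exp_le_mix_exp hq0 hq
  set r := 1 - q + q * Real.exp u
  set r' := 1 - q + q * Real.exp u'
  have hr0 : 0 < r' := by linarith
  have hy : 1 + (r - r') / r' = r / r' := by field_simp; ring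
  have h := one_add_pow_le (y := (r - r') / r') (by
    have : 0 < r / r' := by positivity
    linarith) (k + 1)
  rw [hy] at h
  have hW : max 1 ((r / r') ^ (k + 1)) ≤
      Real.exp ((k + 1) * (2 * q * |u| + u ^ 2 + q * |u'|)) := by
    refine max_le (Real.one_le_exp (by positivity)) ?_
    calc (r / r') ^ (k + 1) ≤ Real.exp (2 * q * |u| + u ^ 2 + q * |u'|) ^ (k + 1) := by gcongr
      _ = _ := by rw [← Real.exp_nat_mul]; push_cast; rfl
  have h2 : r ^ (k + 1) / r' ^ k = r' * (r / r') ^ (k + 1) := by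
    rw [div_pow, pow_succ r' k]
    field_simp
  have h3 := mul_le_mul_of_nonneg_left h hr0.le
  have h4 : r' * (1 + ((k + 1 : ℕ) : ℝ) * ((r - r') / r') + ((k + 1 : ℕ) : ℝ) ^ 2 *
      ((r - r') / r') ^ 2 * max 1 ((r / r') ^ (k + 1))) =
      r' + (k + 1) * (r - r') + (k + 1) ^ 2 * ((r - r') ^ 2 *
        (max 1 ((r / r') ^ (k + 1)) * (1 / r'))) := by
    push_cast
    field_simp
  have h5 : max 1 ((r / r') ^ (k + 1)) * (1 / r') ≤
      Real.exp ((k + 1) * (2 * q * |u| + u ^ 2 + q * |u'|)) * 2 := by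
    gcongr
    rw [div_le_iff₀ hr0]
    linarith
  have h6 : ((k : ℝ) + 1) ^ 2 * ((r - r') ^ 2 * (max 1 ((r / r') ^ (k + 1)) * (1 / r'))) ≤
      (k + 1) ^ 2 * ((r - r') ^ 2 *
        (Real.exp ((k + 1) * (2 * q * |u| + u ^ 2 + q * |u'|)) * 2)) := by gcongr
  rw [h4] at h3
  rw [hd] at h6
  rw [h2]
  rw [hd] at h3
  nlinarith

theorem abs_exp_sub_one_le_mul (u : ℝ) : |Real.exp u - 1| ≤ |u| * Real.exp |u| := by
  rcases le_total 0 u with h | h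
  · rw [abs_of_nonneg h, abs_of_nonneg (by linarith [Real.one_le_exp h])]
    have := Real.add_one_le_exp (-u)
    have h1 : Real.exp u * Real.exp (-u) = 1 := by rw [← Real.exp_add]; simp
    nlinarith [Real.exp_pos u]
  · have h1 : Real.exp u ≤ 1 := Real.exp_le_one_iff.2 h
    rw [abs_of_nonpos h, abs_of_nonpos (by linarith)]
    have := Real.add_one_le_exp u
    have := Real.one_le_exp (neg_nonneg.2 h)
    nlinarith

theorem remainder_le {s x y u u' q K : ℝ} (hs0 : 0 ≤ s) (hs : s ≤ 1) (hx : 0 ≤ x) (hy : 0 ≤ y)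
    (hu : |u| ≤ s * (x + 1)) (hu' : |u'| ≤ s * (y + 1)) (hq0 : 0 ≤ q) (hK : 0 ≤ K)
    (hKs : K * s ^ 2 ≤ 1 / 64) :
    2 * (Real.exp u - Real.exp u') ^ 2 * Real.exp (K * (2 * q * |u| + u ^ 2 + q * |u'|)) ≤
      s ^ 2 * (Real.exp (271 + 41 * (K * q * s) ^ 2) / 2) *
        (Real.exp (x ^ 2 / 4) + Real.exp (y ^ 2 / 4)) := by
  have aux : ∀ {u x : ℝ}, 0 ≤ x → |u| ≤ s * (x + 1) →
      (Real.exp u - 1) ^ 2 ≤ s ^ 2 * Real.exp (4 * x + 4) := by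
    intro u x hx hu
    have h1 := abs_exp_sub_one_le_mul u
    have h2 : |u| * Real.exp |u| ≤ s * Real.exp (2 * x + 2) := by
      calc |u| * Real.exp |u| ≤ (s * (x + 1)) * Real.exp (x + 1) := by
            gcongr
            exact hu.trans (by nlinarith)
        _ ≤ (s * Real.exp (x + 1)) * Real.exp (x + 1) := by
            gcongr
            linarith [Real.add_one_le_exp (x + 1)]
        _ = _ := by rw [mul_assoc, ← Real.exp_add]; congr 2; ring
    rw [← sq_abs]
    calc |Real.exp u - 1| ^ 2 ≤ (s * Real.exp (2 * x + 2)) ^ 2 := by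
          gcongr
          exact h1.trans h2
      _ = _ := by rw [mul_pow, ← Real.exp_nat_mul]; congr 2; push_cast; ring
  have hdiff : (Real.exp u - Real.exp u') ^ 2 ≤ 4 * s ^ 2 * Real.exp (4 * x + 4 * y + 8) := by
    have h1 := aux hx hu
    have h2 := aux hy hu'
    have h3 : Real.exp (4 * x + 4) ≤ Real.exp (4 * x + 4 * y + 8) :=
      Real.exp_le_exp.2 (by linarith)
    have h4 : Real.exp (4 * y + 4) ≤ Real.exp (4 * x + 4 * y + 8) :=
      Real.exp_le_exp.2 (by linarith)
    have h5 := mul_le_mul_of_nonneg_left h3 (sq_nonneg s)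
    have h6 := mul_le_mul_of_nonneg_left h4 (sq_nonneg s)
    nlinarith [sq_nonneg ((Real.exp u - 1) + (Real.exp u' - 1))]
  set θ := K * q * s with hθ
  have hθ0 : 0 ≤ θ := by positivity
  have hsq : u ^ 2 ≤ (s * (x + 1)) ^ 2 := by
    rw [← sq_abs]
    gcongr
  have hexp : K * (2 * q * |u| + u ^ 2 + q * |u'|) ≤
      2 * θ * (x + 1) + (K * s ^ 2) * (x + 1) ^ 2 + θ * (y + 1) := by
    calc _ ≤ K * (2 * q * (s * (x + 1)) + (s * (x + 1)) ^ 2 + q * (s * (y + 1))) := by gcongr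
      _ = _ := by rw [hθ]; ring
  have hKx : (K * s ^ 2) * (x + 1) ^ 2 ≤ 1 / 64 * (x + 1) ^ 2 := by gcongr
  -- Young's inequality absorbs all linear terms into `x²/8 + y²/8`, the cross terms with `θ` giving
  -- `41 θ²`. The summand 3 pays for the prefactor `8 ≤ exp 3`.
  have htot : (4 * x + 4 * y + 8) + K * (2 * q * |u| + u ^ 2 + q * |u'|) + 3 ≤
      271 + 41 * θ ^ 2 + (x ^ 2 / 8 + y ^ 2 / 8) := by
    nlinarith [sq_nonneg (x - 64), sq_nonneg (y - 64), sq_nonneg (x - 32 * θ),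
      sq_nonneg (y - 16 * θ), sq_nonneg (θ - 1), sq_nonneg (x - 1)]
  have h8 : (8 : ℝ) ≤ Real.exp 3 := by
    have := Real.add_one_le_exp (1 : ℝ)
    calc (8 : ℝ) = 2 ^ 3 := by norm_num
      _ ≤ Real.exp 1 ^ 3 := by gcongr; linarith
      _ = _ := by rw [← Real.exp_nat_mul]; norm_num
  have hamgm : Real.exp (x ^ 2 / 8 + y ^ 2 / 8) ≤
      (Real.exp (x ^ 2 / 4) + Real.exp (y ^ 2 / 4)) / 2 := by
    have e1 : Real.exp (x ^ 2 / 4) = Real.exp (x ^ 2 / 8) ^ 2 := by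
      rw [← Real.exp_nat_mul]; congr 1; push_cast; ring
    have e2 : Real.exp (y ^ 2 / 4) = Real.exp (y ^ 2 / 8) ^ 2 := by
      rw [← Real.exp_nat_mul]; congr 1; push_cast; ring
    rw [e1, e2, Real.exp_add]
    nlinarith [sq_nonneg (Real.exp (x ^ 2 / 8) - Real.exp (y ^ 2 / 8))]
  calc _ ≤ 2 * (4 * s ^ 2 * Real.exp (4 * x + 4 * y + 8)) *
        Real.exp (K * (2 * q * |u| + u ^ 2 + q * |u'|)) := by gcongr
    _ = s ^ 2 * (Real.exp (4 * x + 4 * y + 8) *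
        Real.exp (K * (2 * q * |u| + u ^ 2 + q * |u'|)) * 8) := by ring
    _ ≤ s ^ 2 * (Real.exp (4 * x + 4 * y + 8) *
        Real.exp (K * (2 * q * |u| + u ^ 2 + q * |u'|)) * Real.exp 3) := by gcongr
    _ = s ^ 2 * Real.exp ((4 * x + 4 * y + 8) + K * (2 * q * |u| + u ^ 2 + q * |u'|) + 3) := by
      rw [Real.exp_add _ 3, Real.exp_add (4 * x + 4 * y + 8)]
    _ ≤ s ^ 2 * Real.exp (271 + 41 * θ ^ 2 + (x ^ 2 / 8 + y ^ 2 / 8)) := by gcongr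
    _ = s ^ 2 * (Real.exp (271 + 41 * θ ^ 2) * Real.exp (x ^ 2 / 8 + y ^ 2 / 8)) := by
      rw [Real.exp_add _ (x ^ 2 / 8 + y ^ 2 / 8)]
    _ ≤ s ^ 2 * (Real.exp (271 + 41 * θ ^ 2) *
        ((Real.exp (x ^ 2 / 4) + Real.exp (y ^ 2 / 4)) / 2)) := by gcongr
    _ = _ := by ring

/-- Used with `t = ((k+1) q s)²`, which need not be small: the growth `exp (41 t)` is absorbed in
the linear exponent. -/
theorem one_add_mul_exp_le {t : ℝ} (ht : 0 ≤ t) :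
    1 + 2 * t * Real.exp (271 + 41 * t) ≤ Real.exp ((2 * Real.exp 271 + 41) * t) := by
  have h1 : 1 + 2 * t * Real.exp (271 + 41 * t) ≤
      (1 + 2 * Real.exp 271 * t) * Real.exp (41 * t) := by
    rw [Real.exp_add]
    nlinarith [Real.one_le_exp (by positivity : 0 ≤ 41 * t)]
  have h2 : 1 + 2 * Real.exp 271 * t ≤ Real.exp (2 * Real.exp 271 * t) := by
    linarith [Real.add_one_le_exp (2 * Real.exp 271 * t)]
  calc _ ≤ _ := h1
    _ ≤ Real.exp (2 * Real.exp 271 * t) * Real.exp (41 * t) := by gcongr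
    _ = _ := by rw [← Real.exp_add]; congr 1; ring

end Scalar

/-! ### Divergence between shifted and between mixed Gaussians. -/

section GaussianDivergence

variable {p : ℕ} {σ : ℝ}

theorem holderDominated_shift {k : ℕ} (hk : 0 < k) (hσ : 0 < σ)
    (w : EuclideanSpace ℝ (Fin p)) :
    HolderDominated k (ENNReal.ofReal (Real.exp (k * ‖w‖ ^ 2 / (2 * σ ^ 2)))) (isoGaussian p σ)
      ((isoGaussian p σ).map fun x => w + x) := by
  have h := HolderDominated.of_density (η := isoGaussian p σ) (f := fun _ => 1) (g := tilt σ w) hk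
    measurable_const (measurable_tilt σ w) (fun _ => zero_le_one) (tilt_pos σ w)
    (M := ENNReal.ofReal (Real.exp (k * ‖w‖ ^ 2 / (2 * σ ^ 2) * (k + 1)))) ?_
  · rw [ENNReal.ofReal_one] at h
    have h1 : (isoGaussian p σ).withDensity (fun _ => (1 : ℝ≥0∞)) = isoGaussian p σ :=
      withDensity_one
    rw [h1] at h
    rw [isoGaussian_map_add hσ]
    refine h.mono (le_of_eq ?_)
    rw [ENNReal.ofReal_rpow_of_nonneg (Real.exp_pos _).le (by positivity), ← Real.exp_mul]
    congr 2
    field_simp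
  · have e : ∀ x, ENNReal.ofReal (1 ^ (k + 1) / tilt σ w x ^ k) =
        ENNReal.ofReal (Real.exp (k * ‖w‖ ^ 2 / (2 * σ ^ 2))) *
          ENNReal.ofReal (Real.exp (inner ℝ ((-(k : ℝ)) • w) x / σ ^ 2)) := by
      intro x
      rw [← ENNReal.ofReal_mul (Real.exp_pos _).le, tilt, ← Real.exp_nat_mul, one_pow, one_div,
        ← Real.exp_neg, ← Real.exp_add, real_inner_smul_left]
      congr 2
      ring
    simp only [e]
    rw [lintegral_const_mul _ (by fun_prop), lintegral_exp_inner hσ,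
      ← ENNReal.ofReal_mul (Real.exp_pos _).le, ← Real.exp_add]
    refine le_of_eq ?_
    congr 2
    rw [norm_smul, norm_neg, Real.norm_natCast]
    ring

/-- The mixture of `N(0, σ² I)` and `N(a, σ² I)` with weights `1 - q` and `q`. -/
def gaussianMix (σ q : ℝ) (a : EuclideanSpace ℝ (Fin p)) : Measure (EuclideanSpace ℝ (Fin p)) :=
  ENNReal.ofReal (1 - q) • isoGaussian p σ +
    ENNReal.ofReal q • (isoGaussian p σ).map fun x => a + x

theorem gaussianMix_eq_withDensity {q : ℝ} (hσ : 0 < σ) (hq0 : 0 ≤ q) (hq : q ≤ 1)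
    (a : EuclideanSpace ℝ (Fin p)) :
    gaussianMix σ q a =
      (isoGaussian p σ).withDensity fun x => ENNReal.ofReal (1 - q + q * tilt σ a x) := by
  have e : (fun x => ENNReal.ofReal (1 - q + q * tilt σ a x)) =
      (fun _ => ENNReal.ofReal (1 - q)) +
        ENNReal.ofReal q • fun x => ENNReal.ofReal (tilt σ a x) := by
    funext x
    rw [Pi.add_apply, Pi.smul_apply, smul_eq_mul, ← ENNReal.ofReal_mul hq0,
      ← ENNReal.ofReal_add (by linarith) (mul_nonneg hq0 (tilt_pos _ _ _).le)]
  rw [gaussianMix, isoGaussian_map_add hσ, e, withDensity_add_left measurable_const,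
    withDensity_smul _ (measurable_tilt σ a).ennreal_ofReal, withDensity_const]

theorem lintegral_mix {q : ℝ} (hσ : 0 < σ) (hq0 : 0 ≤ q) (hq : q ≤ 1)
    (a : EuclideanSpace ℝ (Fin p)) :
    ∫⁻ x, ENNReal.ofReal (1 - q + q * tilt σ a x) ∂isoGaussian p σ = 1 := by
  have e : ∀ x, ENNReal.ofReal (1 - q + q * tilt σ a x) =
      ENNReal.ofReal (1 - q) + ENNReal.ofReal q * ENNReal.ofReal (tilt σ a x) := by
    intro x
    rw [← ENNReal.ofReal_mul hq0,
      ← ENNReal.ofReal_add (by linarith) (mul_nonneg hq0 (tilt_pos _ _ _).le)]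
  simp only [e]
  rw [lintegral_add_left measurable_const,
    lintegral_const_mul _ (measurable_tilt σ a).ennreal_ofReal, lintegral_tilt hσ]
  simp only [lintegral_const, measure_univ, mul_one]
  rw [← ENNReal.ofReal_add (by linarith) hq0]
  simp

theorem abs_log_tilt_le {s : ℝ} (hσ : 0 < σ) (hs0 : 0 < s) (hs : s ≤ 1)
    {a : EuclideanSpace ℝ (Fin p)} (ha : ‖a‖ ≤ s * σ) (x : EuclideanSpace ℝ (Fin p)) :
    |inner ℝ a x / σ ^ 2 - ‖a‖ ^ 2 / (2 * σ ^ 2)| ≤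
      s * (|inner ℝ (s⁻¹ • a) x / σ ^ 2| + 1) := by
  have h1 : inner ℝ a x / σ ^ 2 = s * (inner ℝ (s⁻¹ • a) x / σ ^ 2) := by
    rw [real_inner_smul_left]
    field_simp
  have h2 : ‖a‖ ^ 2 / (2 * σ ^ 2) ≤ s := by
    rw [div_le_iff₀ (by positivity)]
    calc ‖a‖ ^ 2 ≤ (s * σ) ^ 2 := by gcongr
      _ = s * (s * σ ^ 2) := by ring
      _ ≤ s * (2 * σ ^ 2) := by
        gcongr
        linarith
  rw [h1]
  refine (abs_sub _ _).trans ?_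
  rw [abs_mul, abs_of_pos hs0, abs_of_nonneg (by positivity : 0 ≤ ‖a‖ ^ 2 / (2 * σ ^ 2))]
  linarith

/-- The constant in the bound on the divergence between two subsampled Gaussians. -/
def mixConst : ℝ := 2 * Real.exp 271 + 41

theorem mixConst_pos : 0 < mixConst := by
  unfold mixConst
  positivity

/-- Integrating the pointwise expansion leaves a Rényi moment of at most `exp (mixConst * θ²)` with
`θ = (k+1) q s`; the root of order `k+1` removes one factor `k+1`. -/
theorem holderDominated_gaussianMix {k : ℕ} (hk : 0 < k) {q s : ℝ} (hσ : 0 < σ) (hq0 : 0 ≤ q)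
    (hq : q ≤ 1 / 2) (hs0 : 0 < s) (hs : s ≤ 1) (hks : ((k : ℝ) + 1) * s ^ 2 ≤ 1 / 64)
    {a b : EuclideanSpace ℝ (Fin p)} (ha : ‖a‖ ≤ s * σ) (hb : ‖b‖ ≤ s * σ) :
    HolderDominated k (ENNReal.ofReal (Real.exp (mixConst * ((k + 1) * q ^ 2 * s ^ 2))))
      (gaussianMix σ q a) (gaussianMix σ q b) := by
  have hmt := fun a : EuclideanSpace ℝ (Fin p) => measurable_tilt σ a
  have hpos : ∀ a x : EuclideanSpace ℝ (Fin p), 0 < 1 - q + q * tilt σ a x := fun a x => by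
    nlinarith [mul_nonneg hq0 (tilt_pos σ a x).le]
  rw [gaussianMix_eq_withDensity hσ hq0 (by linarith),
    gaussianMix_eq_withDensity hσ hq0 (by linarith)]
  set K : ℝ := (k : ℝ) + 1 with hK
  have hK0 : 0 < K := by positivity
  set θ : ℝ := K * q * s with hθ
  have h := HolderDominated.of_density (η := isoGaussian p σ) hk
    (f := fun x => 1 - q + q * tilt σ a x) (g := fun x => 1 - q + q * tilt σ b x)
    (by fun_prop) (by fun_prop) (fun x => (hpos a x).le) (hpos b)
    (M := ENNReal.ofReal (Real.exp (mixConst * θ ^ 2))) ?_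
  · refine h.mono (le_of_eq ?_)
    rw [ENNReal.ofReal_rpow_of_nonneg (Real.exp_pos _).le (by positivity), ← Real.exp_mul]
    congr 2
    rw [← hK, hθ]
    field_simp
  set D : ℝ := Real.exp (271 + 41 * θ ^ 2) / 2 with hD
  have hpt : ∀ x, ENNReal.ofReal ((1 - q + q * tilt σ a x) ^ (k + 1) /
        (1 - q + q * tilt σ b x) ^ k) + ENNReal.ofReal K * ENNReal.ofReal (1 - q + q * tilt σ b x) ≤
      ENNReal.ofReal (1 - q + q * tilt σ b x) +
        ENNReal.ofReal K * ENNReal.ofReal (1 - q + q * tilt σ a x) +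
        ENNReal.ofReal (θ ^ 2 * D) *
          (ENNReal.ofReal (Real.exp ((inner ℝ (s⁻¹ • a) x / σ ^ 2) ^ 2 / 4)) +
            ENNReal.ofReal (Real.exp ((inner ℝ (s⁻¹ • b) x / σ ^ 2) ^ 2 / 4))) := by
    intro x
    have hA := (hpos a x).le
    have hB := (hpos b x).le
    have hθD : 0 ≤ θ ^ 2 * D := by positivity
    rw [← ENNReal.ofReal_mul hK0.le, ← ENNReal.ofReal_mul hK0.le,
      ← ENNReal.ofReal_add (Real.exp_pos _).le (Real.exp_pos _).le,
      ← ENNReal.ofReal_mul hθD, ← ENNReal.ofReal_add (by positivity) (by positivity),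
      ← ENNReal.ofReal_add hB (by positivity), ← ENNReal.ofReal_add (by positivity) (by positivity)]
    refine ENNReal.ofReal_le_ofReal ?_
    refine (mix_exp_pow_div_le hq0 hq k).trans ?_
    have hrem := remainder_le (K := K) hs0.le hs (abs_nonneg _) (abs_nonneg _)
      (abs_log_tilt_le hσ hs0 hs ha x) (abs_log_tilt_le hσ hs0 hs hb x) hq0 hK0.le hks
    rw [sq_abs, sq_abs] at hrem
    have h1 := mul_le_mul_of_nonneg_left hrem (by positivity : 0 ≤ K ^ 2 * q ^ 2)
    refine add_le_add_right (h1.trans_eq ?_) _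
    rw [hD, hθ]
    ring
  have hint := lintegral_mono (μ := isoGaussian p σ) hpt
  have hscale : ∀ {c : EuclideanSpace ℝ (Fin p)}, ‖c‖ ≤ s * σ → ‖s⁻¹ • c‖ ≤ σ := by
    intro c hc
    rw [norm_smul, norm_inv, Real.norm_eq_abs, abs_of_pos hs0, inv_mul_le_iff₀ hs0]
    exact hc
  rw [lintegral_add_right _ (by fun_prop), lintegral_add_left (by fun_prop),
    lintegral_add_left (by fun_prop), lintegral_const_mul _ (by fun_prop),
    lintegral_const_mul _ (by fun_prop), lintegral_const_mul _ (by fun_prop),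
    lintegral_add_left (by fun_prop), lintegral_mix hσ hq0 (by linarith),
    lintegral_mix hσ hq0 (by linarith), mul_one, add_right_comm] at hint
  -- Both mixtures have mass 1, so the first-order contributions on the two sides are the same
  -- finite `K` and cancel.
  have hfin := (ENNReal.add_le_add_iff_right ENNReal.ofReal_ne_top).1 hint
  refine hfin.trans ?_
  calc _ ≤ 1 + ENNReal.ofReal (θ ^ 2 * D) * (2 + 2) := by
        gcongr
        · exact lintegral_exp_sq_inner_le hσ _ (hscale ha)
        · exact lintegral_exp_sq_inner_le hσ _ (hscale hb)
    _ = ENNReal.ofReal (1 + 2 * θ ^ 2 * Real.exp (271 + 41 * θ ^ 2)) := by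
        rw [show (2 + 2 : ℝ≥0∞) = ENNReal.ofReal 4 by norm_num,
          ← ENNReal.ofReal_mul (by positivity), ← ENNReal.ofReal_one,
          ← ENNReal.ofReal_add zero_le_one (by positivity)]
        congr 1
        rw [hD]
        ring
    _ ≤ _ := ENNReal.ofReal_le_ofReal (one_add_mul_exp_le (sq_nonneg θ))

end GaussianDivergence

/-! ### One noisy step with a uniformly sampled index. -/

section Subsampling

variable {p n : ℕ} {σ : ℝ}

theorem lintegral_uniformOn_univ {ι : Type*} [Fintype ι] [Nonempty ι] [MeasurableSpace ι]
    [MeasurableSingletonClass ι] (g : ι → ℝ≥0∞) :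
    ∫⁻ i, g i ∂uniformOn (Set.univ : Set ι) = (Fintype.card ι : ℝ≥0∞)⁻¹ * ∑ i, g i := by
  rw [uniformOn, ProbabilityTheory.cond, Measure.restrict_univ, lintegral_smul_measure, lintegral_count,
    tsum_fintype, Measure.count_univ]
  simp

/-- The law of `a i + u` for a uniform index `i` and a Gaussian noise vector `u`. -/
def noisyLaw (σ : ℝ) (a : Fin n → EuclideanSpace ℝ (Fin p)) : Measure (EuclideanSpace ℝ (Fin p)) :=
  ((uniformOn (Set.univ : Set (Fin n))).prod (isoGaussian p σ)).map fun c => a c.1 + c.2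

theorem measurable_index_add (a : Fin n → EuclideanSpace ℝ (Fin p)) :
    Measurable fun c : Fin n × EuclideanSpace ℝ (Fin p) => a c.1 + c.2 :=
  ((Measurable.of_discrete (f := a)).comp measurable_fst).add measurable_snd

theorem lintegral_noisyLaw [Nonempty (Fin n)] (a : Fin n → EuclideanSpace ℝ (Fin p))
    {g : EuclideanSpace ℝ (Fin p) → ℝ≥0∞} (hg : Measurable g) :
    ∫⁻ x, g x ∂noisyLaw σ a = (n : ℝ≥0∞)⁻¹ * ∑ i, ∫⁻ x, g (a i + x) ∂isoGaussian p σ := by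
  have hm : Measurable fun c : Fin n × EuclideanSpace ℝ (Fin p) => g (a c.1 + c.2) :=
    hg.comp (measurable_index_add a)
  rw [noisyLaw, lintegral_map hg (measurable_index_add a), lintegral_prod _ hm.aemeasurable,
    lintegral_uniformOn_univ, Fintype.card_fin]

theorem noisyLaw_eq_bind [Nonempty (Fin n)] (a : Fin n → EuclideanSpace ℝ (Fin p)) :
    noisyLaw σ a = (uniformOn (Set.univ : Set (Fin n))).bind
      fun i => (isoGaussian p σ).map fun x => a i + x := by
  refine Measure.ext_of_lintegral _ fun g hg => ?_
  rw [lintegral_noisyLaw a hg,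
    Measure.lintegral_bind Measurable.of_discrete.aemeasurable hg.aemeasurable,
    lintegral_uniformOn_univ, Fintype.card_fin]
  congr 1
  refine Finset.sum_congr rfl fun i _ => ?_
  rw [lintegral_map hg (by fun_prop)]

theorem holderDominated_noisyLaw_shift [Nonempty (Fin n)] {k : ℕ} (hk : 0 < k) (hσ : 0 < σ)
    (a : Fin n → EuclideanSpace ℝ (Fin p)) (w : EuclideanSpace ℝ (Fin p)) :
    HolderDominated k (ENNReal.ofReal (Real.exp (k * ‖w‖ ^ 2 / (2 * σ ^ 2)))) (noisyLaw σ a)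
      (noisyLaw σ fun i => a i + w) := by
  rw [noisyLaw_eq_bind, noisyLaw_eq_bind, ← one_mul (ENNReal.ofReal _)]
  refine HolderDominated.bind hk Measurable.of_discrete Measurable.of_discrete
    (HolderDominated.refl hk _) fun i => ?_
  have h := (holderDominated_shift (p := p) hk hσ w).map (f := fun x => a i + x) (by fun_prop)
  rw [Measure.map_map (by fun_prop) (by fun_prop)] at h
  have e : (fun x => a i + w + x) = (fun x => a i + x) ∘ fun x => w + x := by
    funext x
    simp [add_assoc]
  rw [e]
  exact h

theorem lintegral_map_gaussianMix {q : ℝ} (a c : EuclideanSpace ℝ (Fin p))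
    {g : EuclideanSpace ℝ (Fin p) → ℝ≥0∞} (hg : Measurable g) :
    ∫⁻ x, g x ∂(gaussianMix σ q (a - c)).map (fun x => c + x) =
      ENNReal.ofReal (1 - q) * ∫⁻ x, g (c + x) ∂isoGaussian p σ +
        ENNReal.ofReal q * ∫⁻ x, g (a + x) ∂isoGaussian p σ := by
  rw [lintegral_map hg (by fun_prop), gaussianMix, lintegral_add_measure, lintegral_smul_measure,
    lintegral_smul_measure, lintegral_map (by fun_prop) (by fun_prop)]
  simp [← add_assoc]

/-- The mass `1/n` of index `j` is spread evenly over the other `n-1` indices, each of which keeps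
weight `1/(n-1) * (1 - 1/n) = 1/n` for its own centre. -/
theorem noisyLaw_eq_bind_gaussianMix (hn : 2 ≤ n) (j : Fin n)
    (a : Fin n → EuclideanSpace ℝ (Fin p)) :
    noisyLaw σ a = (uniformOn (Set.univ : Set {i : Fin n // i ≠ j})).bind
      fun i => (gaussianMix σ (1 / n) (a j - a i)).map fun x => a i + x := by
  have : Nonempty (Fin n) := ⟨j⟩
  have hcard : Fintype.card {i : Fin n // i ≠ j} = n - 1 := by
    rw [Fintype.card_subtype_compl, Fintype.card_fin, Fintype.card_subtype_eq]
  have : Nonempty {i : Fin n // i ≠ j} := Fintype.card_pos_iff.1 (by omega)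
  have hn0 : (0 : ℝ) < n := by exact_mod_cast (by omega : 0 < n)
  have hn1 : (0 : ℝ) < (n : ℝ) - 1 := by
    have : (2 : ℝ) ≤ n := by exact_mod_cast hn
    linarith
  have hi : ((n : ℕ) : ℝ≥0∞)⁻¹ = ENNReal.ofReal (1 / n) := by
    rw [one_div, ENNReal.ofReal_inv_of_pos hn0, ENNReal.ofReal_natCast]
  have hi' : ((n - 1 : ℕ) : ℝ≥0∞)⁻¹ = ENNReal.ofReal (1 / ((n : ℝ) - 1)) := by
    rw [one_div, ENNReal.ofReal_inv_of_pos hn1, ← ENNReal.ofReal_natCast, Nat.cast_sub (by omega)]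
    simp
  refine Measure.ext_of_lintegral _ fun g hg => ?_
  rw [lintegral_noisyLaw a hg,
    Measure.lintegral_bind Measurable.of_discrete.aemeasurable hg.aemeasurable,
    lintegral_uniformOn_univ, hcard]
  simp only [lintegral_map_gaussianMix _ _ hg]
  rw [Finset.sum_add_distrib, ← Finset.mul_sum, Finset.sum_const, Finset.card_univ, hcard,
    nsmul_eq_mul, mul_add, hi, hi', ← mul_assoc, ← mul_assoc,
    ← ENNReal.ofReal_mul (by positivity), ← ENNReal.ofReal_natCast,
    ← mul_assoc, ← ENNReal.ofReal_mul (by positivity), Nat.cast_sub (by omega)]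
  have e1 : 1 / ((n : ℝ) - 1) * (1 - 1 / n) = 1 / n := by field_simp
  have e2 : 1 / ((n : ℝ) - 1) * ((n : ℝ) - (1 : ℕ)) = 1 := by
    push_cast
    field_simp
  rw [e1, e2, ENNReal.ofReal_one, one_mul, ← mul_add]
  congr 1
  rw [← Finset.sum_subtype (Finset.univ.erase j) (by simp)
    (fun i => ∫⁻ x, g (a i + x) ∂isoGaussian p σ), Finset.sum_erase_add _ _ (Finset.mem_univ j)]

theorem holderDominated_noisyLaw_of_eq_off {k : ℕ} (hk : 0 < k) (hn : 2 ≤ n) {s : ℝ} (hσ : 0 < σ)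
    (hs0 : 0 < s) (hs : s ≤ 1) (hks : ((k : ℝ) + 1) * s ^ 2 ≤ 1 / 64) (j : Fin n)
    {a b : Fin n → EuclideanSpace ℝ (Fin p)} (hab : ∀ i, i ≠ j → a i = b i)
    (ha : ∀ i, ‖a j - a i‖ ≤ s * σ) (hb : ∀ i, ‖b j - b i‖ ≤ s * σ) :
    HolderDominated k (ENNReal.ofReal (Real.exp (mixConst * ((k + 1) * (1 / n) ^ 2 * s ^ 2))))
      (noisyLaw σ a) (noisyLaw σ b) := by
  have hcard : Fintype.card {i : Fin n // i ≠ j} = n - 1 := by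
    rw [Fintype.card_subtype_compl, Fintype.card_fin, Fintype.card_subtype_eq]
  have : Nonempty {i : Fin n // i ≠ j} := Fintype.card_pos_iff.1 (by omega)
  have hn2 : (2 : ℝ) ≤ n := by exact_mod_cast hn
  rw [noisyLaw_eq_bind_gaussianMix hn j a, noisyLaw_eq_bind_gaussianMix hn j b,
    ← one_mul (ENNReal.ofReal _)]
  refine HolderDominated.bind hk Measurable.of_discrete Measurable.of_discrete
    (HolderDominated.refl hk _) fun i => ?_
  rw [← hab i i.2]
  refine HolderDominated.map (by fun_prop) (holderDominated_gaussianMix hk hσ (by positivity)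
    ?_ hs0 hs hks (ha i) ?_)
  · rw [div_le_div_iff₀ (by linarith) (by norm_num)]
    linarith
  · rw [hab i i.2]
    exact hb i

/-- The constant in the bound on the divergence caused by one noisy step. -/
def stepConst : ℝ := 48 * mixConst + 108

theorem stepConst_pos : 0 < stepConst := by
  have := mixConst_pos
  unfold stepConst
  positivity

/-- The intermediate law has centres `a i + w`: it is a common translate of the first law and
differs from the second only in centre `j`. The legs are taken at parameters `2k+1` and `2k`, both
bounds being at most `3k` up to the extra 1 in `2k+1`. -/
theorem holderDominated_noisyLaw {k : ℕ} (hk : 0 < k) {G : ℝ} (hσ : 0 < σ) (hG : 0 < G)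
    (hks : (2 * (k : ℝ) + 1) * (16 * G ^ 2) ≤ σ ^ 2 / 64) (j : Fin n)
    {a b : Fin n → EuclideanSpace ℝ (Fin p)} {w : EuclideanSpace ℝ (Fin p)}
    (hw : ‖w‖ ≤ 2 * G / n) (hab : ∀ i, i ≠ j → b i = a i + w) (hj : ‖b j - (a j + w)‖ ≤ 4 * G)
    (ha : ∀ i i', ‖a i - a i'‖ ≤ 4 * G) (hb : ∀ i i', ‖b i - b i'‖ ≤ 4 * G) :
    HolderDominated k (ENNReal.ofReal (Real.exp (stepConst * k * G ^ 2 / (n ^ 2 * σ ^ 2))))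
      (noisyLaw σ a) (noisyLaw σ b) := by
  have : Nonempty (Fin n) := ⟨j⟩
  have hn0 : 0 < n := j.pos
  have hn0' : (0 : ℝ) < n := by exact_mod_cast hn0
  have hk1 : (1 : ℝ) ≤ k := by exact_mod_cast hk
  have hmc := mixConst_pos
  rcases Nat.lt_or_ge n 2 with h1 | hn
  -- With one entry there is no subsampling: the change is a pure shift by at most `4G + 2G`,
  -- affordable because `1/n² = 1`.
  · have hn1 : n = 1 := by omega
    subst hn1
    have hb' : b = fun i => a i + (b j - a j) := by
      funext i
      rw [Subsingleton.elim i j]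
      abel
    have hnorm : ‖b j - a j‖ ≤ 6 * G := by
      have e : b j - a j = (b j - (a j + w)) + w := by abel
      rw [e]
      refine (norm_add_le _ _).trans ?_
      rw [Nat.cast_one, div_one] at hw
      linarith
    have hsh := holderDominated_noisyLaw_shift hk hσ a (b j - a j)
    rw [← hb'] at hsh
    refine hsh.mono (ENNReal.ofReal_le_ofReal (Real.exp_le_exp.2 ?_))
    rw [Nat.cast_one, one_pow, one_mul, div_le_div_iff₀ (by positivity) (by positivity)]
    have : ‖b j - a j‖ ^ 2 ≤ (6 * G) ^ 2 := by gcongr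
    calc (k : ℝ) * ‖b j - a j‖ ^ 2 * σ ^ 2 ≤ k * (6 * G) ^ 2 * σ ^ 2 := by gcongr
      _ = 18 * (k * G ^ 2 * (2 * σ ^ 2)) := by ring
      _ ≤ stepConst * (k * G ^ 2 * (2 * σ ^ 2)) := by
        gcongr
        unfold stepConst
        linarith
      _ = _ := by ring
  · set s : ℝ := 4 * G / σ with hs
    have hs0 : 0 < s := by positivity
    have hsσ : s * σ = 4 * G := by rw [hs]; field_simp
    have hs2 : s ^ 2 * σ ^ 2 = 16 * G ^ 2 := by rw [hs]; field_simp; ring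
    have hks' : ((2 * k : ℕ) + 1 : ℝ) * s ^ 2 ≤ 1 / 64 := by
      push_cast
      have : (2 * (k : ℝ) + 1) * s ^ 2 * σ ^ 2 ≤ 1 / 64 * σ ^ 2 := by
        rw [mul_assoc, hs2]
        linarith
      exact le_of_mul_le_mul_right this (by positivity)
    have hs1 : s ≤ 1 := by
      have : s ^ 2 ≤ 1 := by
        push_cast at hks'
        nlinarith [sq_nonneg s]
      nlinarith
    have hB := holderDominated_noisyLaw_of_eq_off (k := 2 * k) (by omega) hn hσ hs0 hs1 hks' j
      (a := fun i => a i + w) (b := b) (fun i hi => (hab i hi).symm)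
      (fun i => by simpa [hsσ] using ha j i) (fun i => by simpa [hsσ] using hb j i)
    have hA := holderDominated_noisyLaw_shift (k := 2 * k + 1) (by omega) hσ a w
    refine (HolderDominated.chain hk hA hB ?_).mono ?_
    · rw [← ENNReal.ofReal_one]
      exact ENNReal.ofReal_le_ofReal (Real.one_le_exp (by positivity))
    · rw [← ENNReal.ofReal_mul (Real.exp_pos _).le, ← Real.exp_add]
      refine ENNReal.ofReal_le_ofReal (Real.exp_le_exp.2 ?_)
      have hw2 : ‖w‖ ^ 2 ≤ (2 * G / n) ^ 2 := by gcongr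
      have hs2' : s ^ 2 = 16 * G ^ 2 / σ ^ 2 := by rw [hs]; ring
      push_cast
      rw [hs2']
      calc (2 * (k : ℝ) + 1) * ‖w‖ ^ 2 / (2 * σ ^ 2) +
            mixConst * ((2 * k + 1) * (1 / n) ^ 2 * (16 * G ^ 2 / σ ^ 2))
          ≤ (3 * k) * (2 * G / n) ^ 2 / (2 * σ ^ 2) +
            mixConst * ((3 * k) * (1 / n) ^ 2 * (16 * G ^ 2 / σ ^ 2)) := by
            gcongr <;> linarith
        _ = (48 * mixConst + 6) * (k * G ^ 2 / (n ^ 2 * σ ^ 2)) := by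
            field_simp
            ring
        _ ≤ stepConst * (k * G ^ 2 / (n ^ 2 * σ ^ 2)) := by
            gcongr
            unfold stepConst
            linarith
        _ = _ := by ring

end Subsampling

/-! ### Gradients along the domain and the proximal map. -/

section Convex

open Filter Topology

variable {p : ℕ} {C : Set (EuclideanSpace ℝ (Fin p))}

theorem exists_ball_vectorSpan (hC : Convex ℝ C) (hne : C.Nonempty) :
    ∃ c ∈ C, ∃ ρ > 0, ∀ w ∈ vectorSpan ℝ C, ‖w‖ < ρ → c + w ∈ C := by
  obtain ⟨c, hc⟩ := hne.intrinsicInterior hC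
  obtain ⟨y, hy, rfl⟩ := mem_intrinsicInterior.1 hc
  obtain ⟨ρ, hρ, hball⟩ := Metric.mem_nhds_iff.1 (mem_interior_iff_mem_nhds.1 hy)
  refine ⟨y, intrinsicInterior_subset hc, ρ, hρ, fun w hw hwρ => ?_⟩
  have hmem : w +ᵥ (y : EuclideanSpace ℝ (Fin p)) ∈ affineSpan ℝ C :=
    AffineSubspace.vadd_mem_of_mem_direction (by rwa [direction_affineSpan]) y.2
  have hdist : (⟨_, hmem⟩ : affineSpan ℝ C) ∈ Metric.ball y ρ := by
    rw [Metric.mem_ball, Subtype.dist_eq, dist_eq_norm]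
    change ‖w + (y : EuclideanSpace ℝ (Fin p)) - y‖ < ρ
    rwa [add_sub_cancel_right]
  have h : w +ᵥ (y : EuclideanSpace ℝ (Fin p)) ∈ C := hball hdist
  rwa [vadd_eq_add, add_comm] at h

theorem inner_gradient_le_of_lipschitzOn {F : EuclideanSpace ℝ (Fin p) → ℝ} {G : NNReal}
    (hF : LipschitzOnWith G F C) {y w : EuclideanSpace ℝ (Fin p)} (hy : y ∈ C)
    (hd : DifferentiableAt ℝ F y) {τ : ℝ} (hτ : 0 < τ)
    (hseg : ∀ t : ℝ, 0 < t → t < τ → y + t • w ∈ C) : inner ℝ (gradient F y) w ≤ G * ‖w‖ := by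
  have hline : HasDerivAt (fun t : ℝ => y + t • w) w 0 := by
    simpa using ((hasDerivAt_id (0 : ℝ)).smul_const w).const_add y
  have hder : HasDerivAt (fun t : ℝ => F (y + t • w)) (inner ℝ (gradient F y) w) 0 := by
    rw [inner_gradient_left]
    have h0 : HasFDerivAt F (fderiv ℝ F y) (y + (0 : ℝ) • w) := by simpa using hd.hasFDerivAt
    exact h0.comp_hasDerivAt 0 hline
  refine le_of_tendsto hder.tendsto_slope_zero_right ?_
  filter_upwards [Ioo_mem_nhdsGT hτ] with t ht
  have h1 := hF.dist_le_mul _ (hseg t ht.1 ht.2) _ hy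
  rw [Real.dist_eq, dist_eq_norm, add_sub_cancel_left, norm_smul, Real.norm_eq_abs,
    abs_of_pos ht.1] at h1
  simp only [zero_add, zero_smul, add_zero, smul_eq_mul]
  rw [inv_mul_le_iff₀ ht.1]
  calc _ ≤ _ := le_abs_self _
    _ ≤ _ := h1
    _ = _ := by ring

/-- At a relative boundary point the direction `w` may leave `C` at once. Moving slightly toward a
relative interior point makes every direction of the span admissible, and continuity of the gradient
on `C` passes the bound to the limit. -/
theorem inner_gradient_le_of_mem_vectorSpan (hC : Convex ℝ C)
    {F : EuclideanSpace ℝ (Fin p) → ℝ} {G : NNReal} (hF : LipschitzOnWith G F C)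
    (hd : ∀ x ∈ C, DifferentiableAt ℝ F x) (hg : ContinuousOn (gradient F) C)
    {x w : EuclideanSpace ℝ (Fin p)} (hx : x ∈ C) (hw : w ∈ vectorSpan ℝ C) :
    inner ℝ (gradient F x) w ≤ G * ‖w‖ := by
  obtain ⟨c, hc, ρ, hρ, hball⟩ := exists_ball_vectorSpan hC ⟨x, hx⟩
  set γ : ℝ → EuclideanSpace ℝ (Fin p) := fun s => (1 - s) • x + s • c with hγ
  have hγC : ∀ s ∈ Set.Ioo (0 : ℝ) 1, γ s ∈ C := fun s hs =>
    hC hx hc (by linarith [hs.2]) hs.1.le (by ring)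
  have hγt : Tendsto γ (𝓝[>] 0) (𝓝[C] x) := by
    refine tendsto_nhdsWithin_iff.2 ⟨?_, ?_⟩
    · have : Continuous γ := by fun_prop
      have h := this.tendsto 0
      simp only [hγ, sub_zero, one_smul, zero_smul, add_zero] at h
      exact h.mono_left nhdsWithin_le_nhds
    · filter_upwards [Ioo_mem_nhdsGT zero_lt_one] with s hs using hγC s hs
  have hlim : Tendsto (fun s => inner ℝ (gradient F (γ s)) w) (𝓝[>] 0)
      (𝓝 (inner ℝ (gradient F x) w)) :=
    ((hg x hx).tendsto.comp hγt).inner tendsto_const_nhds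
  refine le_of_tendsto hlim ?_
  filter_upwards [Ioo_mem_nhdsGT zero_lt_one] with s hs
  refine inner_gradient_le_of_lipschitzOn hF (hγC s hs) (hd _ (hγC s hs))
    -- At `γ s` the relative ball has shrunk to radius `s * ρ`; the 1 in the denominator covers `w =
    -- 0`.
    (τ := s * ρ / (‖w‖ + 1)) (by have := hs.1; positivity) fun t ht0 ht => ?_
  have hs0 := hs.1
  have e : γ s + t • w = (1 - s) • x + s • (c + (t / s) • w) := by
    rw [hγ, smul_add, smul_smul, mul_div_cancel₀ _ hs0.ne', add_assoc]
  rw [e]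
  refine hC hx (hball _ (Submodule.smul_mem _ _ hw) ?_) (by linarith [hs.2]) hs0.le (by ring)
  rw [norm_smul, Real.norm_eq_abs, abs_of_pos (by positivity), div_mul_eq_mul_div,
    div_lt_iff₀ hs0]
  rw [lt_div_iff₀ (by positivity)] at ht
  nlinarith [norm_nonneg w]

theorem norm_starProjection_gradient_le (hC : Convex ℝ C)
    {F : EuclideanSpace ℝ (Fin p) → ℝ} {G : NNReal} (hF : LipschitzOnWith G F C)
    (hd : ∀ x ∈ C, DifferentiableAt ℝ F x) (hg : ContinuousOn (gradient F) C)
    {x : EuclideanSpace ℝ (Fin p)} (hx : x ∈ C) :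
    ‖(vectorSpan ℝ C).starProjection (gradient F x)‖ ≤ G := by
  set V := vectorSpan ℝ C
  set w := V.starProjection (gradient F x) with hw
  have hwV : w ∈ V := V.starProjection_apply_mem _
  have h1 := inner_gradient_le_of_mem_vectorSpan hC hF hd hg hx hwV
  have h2 := V.starProjection_inner_eq_zero (gradient F x) w hwV
  rw [← hw, inner_sub_left, sub_eq_zero, real_inner_self_eq_norm_sq] at h2
  rw [h2] at h1
  by_contra! hlt
  have : (0 : ℝ) ≤ G := G.2
  nlinarith

/-- A finite convex function is continuous and falls at most linearly, so the quadratic term makes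
the objective coercive on the closed set `C`. -/
theorem exists_isProxPoint (hcl : IsClosed C) (hne : C.Nonempty)
    {g : EuclideanSpace ℝ (Fin p) → ℝ} (hg : ConvexOn ℝ Set.univ g)
    (y : EuclideanSpace ℝ (Fin p)) : ∃ x, IsProxPoint C g y x := by
  have hcont : Continuous g := hg.locallyLipschitz.continuous
  obtain ⟨ρ, hρ, hball⟩ := Metric.continuous_iff.1 hcont y 1 one_pos
  have hlow : ∀ x, g y - 1 - 2 * ‖x - y‖ / ρ ≤ g x := by
    intro x
    rcases lt_or_ge ‖x - y‖ ρ with h | h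
    · have h1 := hball x (by rwa [dist_eq_norm])
      rw [Real.dist_eq, abs_lt] at h1
      have : 0 ≤ 2 * ‖x - y‖ / ρ := by positivity
      linarith [h1.1]
    · have hpos : 0 < ‖x - y‖ := hρ.trans_le h
      set t := ρ / (2 * ‖x - y‖) with ht
      have ht0 : 0 < t := by positivity
      have ht1 : t ≤ 1 := by
        rw [ht, div_le_one (by positivity)]
        linarith
      have h1 := hball ((1 - t) • y + t • x) (by
        have e : (1 - t) • y + t • x - y = t • (x - y) := by
          rw [sub_smul, one_smul, smul_sub]
          abel
        rw [dist_eq_norm, e, norm_smul, Real.norm_eq_abs, abs_of_pos ht0, ht]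
        field_simp
        linarith)
      rw [Real.dist_eq, abs_lt] at h1
      have h2 := hg.2 (Set.mem_univ y) (Set.mem_univ x) (by linarith : 0 ≤ 1 - t) ht0.le (by ring)
      simp only [smul_eq_mul] at h2
      have h3 : t * (2 * ‖x - y‖ / ρ) = 1 := by
        rw [ht]
        field_simp
      have h4 : t * (g y - 1 - 2 * ‖x - y‖ / ρ) ≤ t * g x := by nlinarith [h1.1]
      exact le_of_mul_le_mul_left h4 ht0
  obtain ⟨x₀, hx₀⟩ := hne
  have hnorm : Tendsto (fun x => ‖x - y‖) (cocompact (EuclideanSpace ℝ (Fin p))) atTop :=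
    tendsto_norm_cocompact_atTop.comp (Homeomorph.subRight y).isClosedEmbedding.tendsto_cocompact
  have hev : ∀ᶠ N : ℝ in atTop, (1 / 2) * ‖x₀ - y‖ ^ 2 + g x₀ ≤
      (1 / 2) * N ^ 2 + (g y - 1 - 2 * N / ρ) := by
    have h1 : Tendsto (fun N : ℝ => N * ((1 / 2) * N - 2 / ρ)) atTop atTop := by
      refine tendsto_id.atTop_mul_atTop₀ ?_
      exact tendsto_atTop_add_const_right _ _ (tendsto_id.const_mul_atTop (by norm_num))
    filter_upwards [h1.eventually_ge_atTop ((1 / 2) * ‖x₀ - y‖ ^ 2 + g x₀ - g y + 1)] with N hN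
    have e : N * ((1 / 2) * N - 2 / ρ) = (1 / 2) * N ^ 2 - 2 * N / ρ := by ring
    linarith
  obtain ⟨x, hxC, hx⟩ := ContinuousOn.exists_isMinOn'
    (f := fun x => (1 / 2) * ‖x - y‖ ^ 2 + g x) (s := C) (by fun_prop) hcl hx₀ (by
      refine Filter.Eventually.filter_mono inf_le_left ?_
      filter_upwards [hnorm.eventually hev] with x hx
      linarith [hlow x])
  exact ⟨x, hxC, fun w hw => hx hw⟩

theorem isProxPoint_prox (hcl : IsClosed C) (hne : C.Nonempty)
    {g : EuclideanSpace ℝ (Fin p) → ℝ} (hg : ConvexOn ℝ Set.univ g)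
    (y : EuclideanSpace ℝ (Fin p)) : IsProxPoint C g y (prox C g y) :=
  Classical.epsilon_spec (exists_isProxPoint hcl hne hg y)

theorem IsProxPoint.inner_le (hC : Convex ℝ C) {g : EuclideanSpace ℝ (Fin p) → ℝ}
    (hg : ConvexOn ℝ Set.univ g) {y x w : EuclideanSpace ℝ (Fin p)} (hx : IsProxPoint C g y x)
    (hw : w ∈ C) : inner ℝ (y - x) (w - x) ≤ g w - g x := by
  have key : ∀ t ∈ Set.Ioo (0 : ℝ) 1,
      inner ℝ (y - x) (w - x) ≤ g w - g x + t * (‖w - x‖ ^ 2 / 2) := by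
    intro t ht
    have hz := hx.2 ((1 - t) • x + t • w) (hC hx.1 hw (by linarith [ht.2]) ht.1.le (by ring))
    have hcv := hg.2 (Set.mem_univ x) (Set.mem_univ w) (by linarith [ht.2] : 0 ≤ 1 - t) ht.1.le
      (by ring)
    simp only [smul_eq_mul] at hcv
    have e : (1 - t) • x + t • w - y = t • (w - x) - (y - x) := by
      rw [sub_smul, one_smul, smul_sub]
      abel
    rw [e, norm_sub_sq_real (t • (w - x)), norm_smul, real_inner_smul_left, mul_pow,
      Real.norm_eq_abs, sq_abs, real_inner_comm, norm_sub_rev y x] at hz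
    have h1 : t * inner ℝ (y - x) (w - x) ≤ t * (g w - g x + t * (‖w - x‖ ^ 2 / 2)) := by
      nlinarith
    exact le_of_mul_le_mul_left h1 ht.1
  have hlim : Tendsto (fun t : ℝ => g w - g x + t * (‖w - x‖ ^ 2 / 2)) (𝓝[>] 0)
      (𝓝 (g w - g x)) := by
    have hc : Continuous fun t : ℝ => g w - g x + t * (‖w - x‖ ^ 2 / 2) := by fun_prop
    have := hc.tendsto 0
    simp only [zero_mul, add_zero] at this
    exact this.mono_left nhdsWithin_le_nhds
  refine ge_of_tendsto hlim ?_
  filter_upwards [Ioo_mem_nhdsGT zero_lt_one] with t ht using key t ht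

/-- Firm nonexpansiveness: add the variational inequalities of the two minimizers, each tested at
the other. -/
theorem IsProxPoint.norm_sub_sq_le (hC : Convex ℝ C) {g : EuclideanSpace ℝ (Fin p) → ℝ}
    (hg : ConvexOn ℝ Set.univ g) {y y' x x' : EuclideanSpace ℝ (Fin p)}
    (hx : IsProxPoint C g y x) (hx' : IsProxPoint C g y' x') :
    ‖x - x'‖ ^ 2 ≤ inner ℝ (y - y') (x - x') := by
  have h1 := hx.inner_le hC hg hx'.1
  have h2 := hx'.inner_le hC hg hx.1
  rw [← real_inner_self_eq_norm_sq]
  simp only [inner_sub_left, inner_sub_right] at h1 h2 ⊢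
  linarith

theorem lipschitzWith_prox (hcl : IsClosed C) (hC : Convex ℝ C) (hne : C.Nonempty)
    {g : EuclideanSpace ℝ (Fin p) → ℝ} (hg : ConvexOn ℝ Set.univ g) :
    LipschitzWith 1 (prox C g) := by
  refine LipschitzWith.of_dist_le_mul fun y y' => ?_
  have h := (isProxPoint_prox hcl hne hg y).norm_sub_sq_le hC hg (isProxPoint_prox hcl hne hg y')
  have h2 := real_inner_le_norm (y - y') (prox C g y - prox C g y')
  rw [NNReal.coe_one, one_mul, dist_eq_norm, dist_eq_norm]
  by_contra! hlt
  nlinarith [norm_nonneg (y - y')]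

/-- Differences of proximal points lie in `vectorSpan ℝ C`, so the right side of firm
nonexpansiveness vanishes. -/
theorem prox_eq_of_sub_mem_orthogonal (hcl : IsClosed C) (hC : Convex ℝ C) (hne : C.Nonempty)
    {g : EuclideanSpace ℝ (Fin p) → ℝ} (hg : ConvexOn ℝ Set.univ g)
    {y y' : EuclideanSpace ℝ (Fin p)} (h : y - y' ∈ (vectorSpan ℝ C)ᗮ) :
    prox C g y = prox C g y' := by
  have hy := isProxPoint_prox hcl hne hg y
  have hy' := isProxPoint_prox hcl hne hg y'
  have h1 := hy.norm_sub_sq_le hC hg hy'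
  have hmem : prox C g y - prox C g y' ∈ vectorSpan ℝ C := vsub_mem_vectorSpan ℝ hy.1 hy'.1
  rw [Submodule.inner_left_of_mem_orthogonal hmem h] at h1
  rw [← sub_eq_zero, ← norm_eq_zero]
  exact pow_eq_zero_iff two_ne_zero |>.1 (le_antisymm h1 (sq_nonneg _))

end Convex

/-! ### Privacy loss of the algorithm with bounded measurable gradient oracles. -/

section Model

variable {p n : ℕ}

/-- The variance-reduced gradient estimate at `x` with reference point `xt`, without noise. -/
def drift (g : Fin n → EuclideanSpace ℝ (Fin p) → EuclideanSpace ℝ (Fin p))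
    (xt x : EuclideanSpace ℝ (Fin p)) (i : Fin n) : EuclideanSpace ℝ (Fin p) :=
  g i x - g i xt + (1 / (n : ℝ)) • ∑ k, g k xt

/-- One inner step on triples of reference point, iterate and sum of the iterates. -/
def transition (P : EuclideanSpace ℝ (Fin p) → EuclideanSpace ℝ (Fin p))
    (g : Fin n → EuclideanSpace ℝ (Fin p) → EuclideanSpace ℝ (Fin p)) (η : ℝ)
    (s : EuclideanSpace ℝ (Fin p) × EuclideanSpace ℝ (Fin p) × EuclideanSpace ℝ (Fin p))
    (c : Fin n × EuclideanSpace ℝ (Fin p)) :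
    EuclideanSpace ℝ (Fin p) × EuclideanSpace ℝ (Fin p) × EuclideanSpace ℝ (Fin p) :=
  (s.1, P (s.2.1 - η • (drift g s.1 s.2.1 c.1 + c.2)),
    s.2.2 + P (s.2.1 - η • (drift g s.1 s.2.1 c.1 + c.2)))

/-- One epoch of the algorithm with gradient oracle `g` and proximal map `P`. -/
def modelEpoch (P : EuclideanSpace ℝ (Fin p) → EuclideanSpace ℝ (Fin p))
    (g : Fin n → EuclideanSpace ℝ (Fin p) → EuclideanSpace ℝ (Fin p)) (η : ℝ) (m : ℕ)
    (xt : EuclideanSpace ℝ (Fin p)) (coins : Fin m → Fin n × EuclideanSpace ℝ (Fin p)) :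
    EuclideanSpace ℝ (Fin p) :=
  (1 / (m : ℝ)) • (run (transition P g η) (xt, xt, 0) m coins).2.2

variable {P : EuclideanSpace ℝ (Fin p) → EuclideanSpace ℝ (Fin p)}
  {g g' : Fin n → EuclideanSpace ℝ (Fin p) → EuclideanSpace ℝ (Fin p)} {η σ : ℝ}

theorem measurable_drift (hg : ∀ i, Measurable (g i)) :
    Measurable fun q : EuclideanSpace ℝ (Fin p) × EuclideanSpace ℝ (Fin p) × Fin n =>
      drift g q.1 q.2.1 q.2.2 := by
  have h : Measurable fun q : Fin n × EuclideanSpace ℝ (Fin p) => g q.1 q.2 :=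
    measurable_from_prod_countable_right hg
  have h1 : Measurable fun q : EuclideanSpace ℝ (Fin p) × EuclideanSpace ℝ (Fin p) × Fin n =>
      g q.2.2 q.2.1 := h.comp (measurable_snd.snd.prodMk measurable_snd.fst)
  have h2 : Measurable fun q : EuclideanSpace ℝ (Fin p) × EuclideanSpace ℝ (Fin p) × Fin n =>
      g q.2.2 q.1 := h.comp (measurable_snd.snd.prodMk measurable_fst)
  have h3 : Measurable fun q : EuclideanSpace ℝ (Fin p) × EuclideanSpace ℝ (Fin p) × Fin n =>
      ∑ k, g k q.1 := Finset.measurable_sum _ fun k _ => (hg k).comp measurable_fst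
  exact (h1.sub h2).add (h3.const_smul (1 / (n : ℝ)))

theorem measurable_transition (hP : Measurable P) (hg : ∀ i, Measurable (g i)) :
    Measurable (Function.uncurry (transition P g η)) := by
  have h1 : Measurable fun q : (EuclideanSpace ℝ (Fin p) × EuclideanSpace ℝ (Fin p) ×
      EuclideanSpace ℝ (Fin p)) × Fin n × EuclideanSpace ℝ (Fin p) =>
      drift g q.1.1 q.1.2.1 q.2.1 := (measurable_drift hg).comp
        (measurable_fst.fst.prodMk (measurable_fst.snd.fst.prodMk measurable_snd.fst))
  have h2 : Measurable fun q : (EuclideanSpace ℝ (Fin p) × EuclideanSpace ℝ (Fin p) ×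
      EuclideanSpace ℝ (Fin p)) × Fin n × EuclideanSpace ℝ (Fin p) =>
      P (q.1.2.1 - η • (drift g q.1.1 q.1.2.1 q.2.1 + q.2.2)) :=
    hP.comp (measurable_fst.snd.fst.sub ((h1.add measurable_snd.snd).const_smul η))
  exact measurable_fst.fst.prodMk (h2.prodMk (measurable_fst.snd.snd.add h2))

theorem measurable_modelEpoch (hP : Measurable P) (hg : ∀ i, Measurable (g i)) (m : ℕ) :
    Measurable (Function.uncurry (modelEpoch P g η m)) := by
  have h := (measurable_run (measurable_transition (η := η) hP hg) m).comp
    (f := fun q : EuclideanSpace ℝ (Fin p) × (Fin m → Fin n × EuclideanSpace ℝ (Fin p)) =>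
      (((q.1, q.1, 0) : EuclideanSpace ℝ (Fin p) × EuclideanSpace ℝ (Fin p) ×
        EuclideanSpace ℝ (Fin p)), q.2)) (by fun_prop)
  exact h.snd.snd.const_smul (1 / (m : ℝ))

theorem holderDominated_drift {k : ℕ} (hk : 0 < k) {G : ℝ} (hσ : 0 < σ) (hG : 0 < G)
    (hks : (2 * (k : ℝ) + 1) * (16 * G ^ 2) ≤ σ ^ 2 / 64) (j : Fin n)
    (hbound : ∀ i x, ‖g i x‖ ≤ G) (hbound' : ∀ i x, ‖g' i x‖ ≤ G)
    (heq : ∀ i, i ≠ j → g i = g' i) (xt x : EuclideanSpace ℝ (Fin p)) :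
    HolderDominated k (ENNReal.ofReal (Real.exp (stepConst * k * G ^ 2 / (n ^ 2 * σ ^ 2))))
      (noisyLaw σ (drift g xt x)) (noisyLaw σ (drift g' xt x)) := by
  have hn0 : (0 : ℝ) < n := by exact_mod_cast j.pos
  have four : ∀ {a b c d : EuclideanSpace ℝ (Fin p)}, ‖a‖ ≤ G → ‖b‖ ≤ G → ‖c‖ ≤ G → ‖d‖ ≤ G →
      ‖(a - b) - (c - d)‖ ≤ 4 * G := by
    intro a b c d ha hb hc hd
    have h1 := norm_sub_le (a - b) (c - d)
    have h2 := norm_sub_le a b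
    have h3 := norm_sub_le c d
    linarith
  have hsum : ∑ k, g' k xt = ∑ k, g k xt + (g' j xt - g j xt) := by
    rw [← Finset.add_sum_erase _ (fun k => g' k xt) (Finset.mem_univ j),
      ← Finset.add_sum_erase _ (fun k => g k xt) (Finset.mem_univ j),
      Finset.sum_congr rfl fun i hi => congrFun (heq i (Finset.ne_of_mem_erase hi)).symm xt]
    abel
  refine holderDominated_noisyLaw hk hσ hG hks j (w := (1 / (n : ℝ)) • (g' j xt - g j xt))
    ?_ ?_ ?_ ?_ ?_
  · rw [norm_smul, Real.norm_eq_abs, abs_of_pos (by positivity), div_mul_eq_mul_div, one_mul]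
    gcongr
    have := norm_sub_le (g' j xt) (g j xt)
    linarith [hbound' j xt, hbound j xt]
  · intro i hi
    rw [drift, drift, heq i hi, hsum, smul_add]
    abel
  · have e : drift g' xt x j - (drift g xt x j + (1 / (n : ℝ)) • (g' j xt - g j xt)) =
        (g' j x - g' j xt) - (g j x - g j xt) := by
      rw [drift, drift, hsum, smul_add]
      abel
    rw [e]
    exact four (hbound' _ _) (hbound' _ _) (hbound _ _) (hbound _ _)
  · intro i i'
    rw [drift, drift, add_sub_add_right_eq_sub]
    exact four (hbound _ _) (hbound _ _) (hbound _ _) (hbound _ _)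
  · intro i i'
    rw [drift, drift, add_sub_add_right_eq_sub]
    exact four (hbound' _ _) (hbound' _ _) (hbound' _ _) (hbound' _ _)

theorem map_transition (hP : Measurable P)
    (s : EuclideanSpace ℝ (Fin p) × EuclideanSpace ℝ (Fin p) × EuclideanSpace ℝ (Fin p)) :
    ((uniformOn (Set.univ : Set (Fin n))).prod (isoGaussian p σ)).map (transition P g η s) =
      (noisyLaw σ (drift g s.1 s.2.1)).map fun v =>
        (s.1, P (s.2.1 - η • v), s.2.2 + P (s.2.1 - η • v)) := by
  rw [noisyLaw, Measure.map_map (by fun_prop) (measurable_index_add _)]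
  rfl

/-- Composition at two levels: the steps of an epoch give the power `m`, and whole epochs, seen as
single transitions, give the power `T`. Carrying the reference point and the running sum in the
state makes each step a post-processing of one noisy drift. -/
theorem holderDominated_model {k : ℕ} (hk : 0 < k) {G : ℝ} (hσ : 0 < σ) (hG : 0 < G)
    (hks : (2 * (k : ℝ) + 1) * (16 * G ^ 2) ≤ σ ^ 2 / 64) (j : Fin n) (hP : Measurable P)
    (hg : ∀ i, Measurable (g i)) (hg' : ∀ i, Measurable (g' i))
    (hbound : ∀ i x, ‖g i x‖ ≤ G) (hbound' : ∀ i x, ‖g' i x‖ ≤ G)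
    (heq : ∀ i, i ≠ j → g i = g' i) (T m : ℕ) (x0 : EuclideanSpace ℝ (Fin p)) :
    HolderDominated k
      ((ENNReal.ofReal (Real.exp (stepConst * k * G ^ 2 / (n ^ 2 * σ ^ 2))) ^ m) ^ T)
      ((coinLaw p n T m σ).map (run (modelEpoch P g η m) x0 T))
      ((coinLaw p n T m σ).map (run (modelEpoch P g' η m) x0 T)) := by
  have : Nonempty (Fin n) := ⟨j⟩
  refine HolderDominated.run _ (measurable_modelEpoch hP hg m) (measurable_modelEpoch hP hg' m) hk
    (fun xt => ?_) x0 T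
  have hrun := HolderDominated.run ((uniformOn (Set.univ : Set (Fin n))).prod (isoGaussian p σ))
    (measurable_transition (η := η) hP hg) (measurable_transition (η := η) hP hg') hk
    (fun s => by
      rw [map_transition hP s, map_transition hP s]
      exact (holderDominated_drift hk hσ hG hks j hbound hbound' heq s.1 s.2.1).map
        (by fun_prop)) (xt, xt, 0) m
  have h := hrun.map (f := fun s => (1 / (m : ℝ)) • s.2.2) (by fun_prop)
  rw [Measure.map_map (by fun_prop) (measurable_run_right (measurable_transition hP hg) _ m),
    Measure.map_map (by fun_prop) (measurable_run_right (measurable_transition hP hg') _ m)] at h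
  exact h

end Model

/-! ### Recursions over `Fin` as iterated maps. -/

section Iteration

variable {S K : Type*}

theorem induction_castSucc (Φ : S → K → S) (s : S) {m : ℕ} (c : Fin (m + 1) → K) (t : Fin (m + 1)) :
    Fin.induction (motive := fun _ => S) s (fun k x => Φ x (c k)) t.castSucc =
      Fin.induction (motive := fun _ => S) s (fun k x => Φ x (c k.castSucc)) t := by
  induction t using Fin.induction with
  | zero => rfl
  | succ t ih =>
    rw [← Fin.succ_castSucc, Fin.induction_succ, Fin.induction_succ, ih]

theorem induction_last (Φ : S → K → S) (s : S) (m : ℕ) (c : Fin m → K) :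
    Fin.induction (motive := fun _ => S) s (fun k x => Φ x (c k)) (Fin.last m) =
      run Φ s m c := by
  induction m with
  | zero => rfl
  | succ m ih =>
    rw [← Fin.succ_last, Fin.induction_succ, induction_castSucc, ih]
    rfl

theorem run_congr_of_mem {Φ Φ' : S → K → S} {C : Set S}
    (h : ∀ s ∈ C, ∀ c, Φ s c = Φ' s c ∧ Φ s c ∈ C) {s : S} (hs : s ∈ C) (m : ℕ) (c : Fin m → K) :
    run Φ s m c = run Φ' s m c ∧ run Φ s m c ∈ C := by
  induction m with
  | zero => exact ⟨rfl, hs⟩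
  | succ m ih =>
    obtain ⟨h1, h2⟩ := ih fun i => c i.castSucc
    have h3 := h _ h2 (c (Fin.last m))
    exact ⟨by rw [run, run, ← h1, h3.1], h3.2⟩

end Iteration

/-! ### The algorithm coincides with its model with projected gradients. -/

section Identification

variable {p n : ℕ} {Z : Type u} {C : Set (EuclideanSpace ℝ (Fin p))}
  {f : EuclideanSpace ℝ (Fin p) → Z → ℝ} {r : EuclideanSpace ℝ (Fin p) → ℝ} {η : ℝ}

/-- The component along `C` of the gradient of the `i`-th loss, extended by zero outside `C`. -/
def projGrad (C : Set (EuclideanSpace ℝ (Fin p))) (f : EuclideanSpace ℝ (Fin p) → Z → ℝ)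
    (D : Fin n → Z) (i : Fin n) : EuclideanSpace ℝ (Fin p) → EuclideanSpace ℝ (Fin p) :=
  C.indicator fun x => (vectorSpan ℝ C).starProjection (gradient (fun w => f w (D i)) x)

theorem measurable_projGrad (hcl : IsClosed C)
    (hg : ∀ z, ContinuousOn (fun x => gradient (fun w => f w z) x) C) (D : Fin n → Z) (i : Fin n) :
    Measurable (projGrad C f D i) := by
  classical
  rw [projGrad, ← Set.piecewise_eq_indicator]
  exact ContinuousOn.measurable_piecewise
    ((vectorSpan ℝ C).starProjection.continuous.comp_continuousOn (hg (D i)))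
    continuousOn_const hcl.measurableSet

theorem norm_projGrad_le (hC : Convex ℝ C) {G : NNReal}
    (hd : ∀ z, ∀ x ∈ C, DifferentiableAt ℝ (fun w => f w z) x)
    (hG : ∀ z, LipschitzOnWith G (fun w => f w z) C)
    (hg : ∀ z, ContinuousOn (fun x => gradient (fun w => f w z) x) C) (D : Fin n → Z) (i : Fin n)
    (x : EuclideanSpace ℝ (Fin p)) : ‖projGrad C f D i x‖ ≤ G := by
  by_cases hx : x ∈ C
  · rw [projGrad, Set.indicator_of_mem hx]
    exact norm_starProjection_gradient_le hC (hG _) (hd _) (hg _) hx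
  · rw [projGrad, Set.indicator_of_notMem hx, norm_zero]
    exact G.2

theorem gradient_empRisk (D : Fin n → Z) {x : EuclideanSpace ℝ (Fin p)}
    (hd : ∀ z, DifferentiableAt ℝ (fun w => f w z) x) :
    gradient (empRisk f D) x = (1 / (n : ℝ)) • ∑ i, gradient (fun w => f w (D i)) x := by
  have h : HasFDerivAt (empRisk f D)
      ((1 / (n : ℝ)) • ∑ i, fderiv ℝ (fun w => f w (D i)) x) x :=
    (HasFDerivAt.fun_sum fun i _ => (hd (D i)).hasFDerivAt).const_mul (1 / (n : ℝ))
  rw [gradient, h.fderiv, map_smulₛₗ, map_sum]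
  simp [gradient]

/-- The true and projected gradient estimates differ by a vector orthogonal to the span of `C`,
which the proximal map ignores; the noise is left unprojected. -/
theorem innerStep_eq (hcl : IsClosed C) (hC : Convex ℝ C)
    (hd : ∀ z, ∀ x ∈ C, DifferentiableAt ℝ (fun w => f w z) x)
    (hr : ConvexOn ℝ Set.univ fun w => η * r w) (D : Fin n → Z) {xt x : EuclideanSpace ℝ (Fin p)}
    (hxt : xt ∈ C) (hx : x ∈ C) (c : Fin n × EuclideanSpace ℝ (Fin p)) :
    innerStep C f r η D xt x c = prox C (fun w => η * r w)
      (x - η • (drift (projGrad C f D) xt x c.1 + c.2)) := by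
  refine prox_eq_of_sub_mem_orthogonal hcl hC ⟨x, hx⟩ hr ?_
  set V := vectorSpan ℝ C
  set v := gradient (fun w => f w (D c.1)) x - gradient (fun w => f w (D c.1)) xt +
    gradient (empRisk f D) xt with hv
  have hdrift : drift (projGrad C f D) xt x c.1 = V.starProjection v := by
    rw [hv, gradient_empRisk D fun z => hd z xt hxt, map_add, map_sub, map_smul, map_sum, drift]
    simp only [projGrad, Set.indicator_of_mem hx, Set.indicator_of_mem hxt]
    rfl
  have e : x - η • (v + c.2) - (x - η • (V.starProjection v + c.2)) =
      (-η) • (v - V.starProjection v) := by module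
  rw [hdrift, e]
  exact Submodule.smul_mem _ _ (V.sub_starProjection_mem_orthogonal v)

theorem innerStep_mem (hcl : IsClosed C) (hr : ConvexOn ℝ Set.univ fun w => η * r w)
    (D : Fin n → Z) {xt x : EuclideanSpace ℝ (Fin p)} (hx : x ∈ C)
    (c : Fin n × EuclideanSpace ℝ (Fin p)) : innerStep C f r η D xt x c ∈ C :=
  (isProxPoint_prox hcl ⟨x, hx⟩ hr _).1

theorem innerIterate_mem (hcl : IsClosed C) (hr : ConvexOn ℝ Set.univ fun w => η * r w)
    (D : Fin n → Z) {xt : EuclideanSpace ℝ (Fin p)} (hxt : xt ∈ C) {m : ℕ}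
    (coins : Fin m → Fin n × EuclideanSpace ℝ (Fin p)) (t : Fin (m + 1)) :
    innerIterate C f r η D m xt coins t ∈ C := by
  unfold innerIterate
  induction t using Fin.induction with
  | zero => exact hxt
  | succ t ih =>
    rw [Fin.induction_succ]
    exact innerStep_mem hcl hr D ih _

theorem epoch_mem (hcl : IsClosed C) (hC : Convex ℝ C)
    (hr : ConvexOn ℝ Set.univ fun w => η * r w) (D : Fin n → Z)
    {xt : EuclideanSpace ℝ (Fin p)} (hxt : xt ∈ C) {m : ℕ} (hm : 0 < m)
    (coins : Fin m → Fin n × EuclideanSpace ℝ (Fin p)) : epoch C f r η D m xt coins ∈ C := by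
  have hm' : (0 : ℝ) < m := by exact_mod_cast hm
  rw [epoch, Finset.smul_sum]
  refine hC.sum_mem (fun _ _ => by positivity) ?_ fun k _ => innerIterate_mem hcl hr D hxt _ _
  rw [Finset.sum_const, Finset.card_univ, Fintype.card_fin, nsmul_eq_mul]
  field_simp

theorem run_transition_eq (hcl : IsClosed C) (hC : Convex ℝ C)
    (hd : ∀ z, ∀ x ∈ C, DifferentiableAt ℝ (fun w => f w z) x)
    (hr : ConvexOn ℝ Set.univ fun w => η * r w) (D : Fin n → Z)
    {xt : EuclideanSpace ℝ (Fin p)} (hxt : xt ∈ C) (m : ℕ)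
    (coins : Fin m → Fin n × EuclideanSpace ℝ (Fin p)) :
    run (transition (prox C fun w => η * r w) (projGrad C f D) η) (xt, xt, 0) m coins =
      (xt, innerIterate C f r η D m xt coins (Fin.last m),
        ∑ k : Fin m, innerIterate C f r η D m xt coins k.succ) := by
  induction m with
  | zero => simp [run, innerIterate]
  | succ m ih =>
    have hcast : ∀ t : Fin (m + 1), innerIterate C f r η D (m + 1) xt coins t.castSucc =
        innerIterate C f r η D m xt (fun i => coins i.castSucc) t :=
      induction_castSucc (innerStep C f r η D xt) xt coins
    have hlast : innerIterate C f r η D (m + 1) xt coins (Fin.last m).succ =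
        prox C (fun w => η * r w)
          (innerIterate C f r η D m xt (fun i => coins i.castSucc) (Fin.last m) -
            η • (drift (projGrad C f D) xt
              (innerIterate C f r η D m xt (fun i => coins i.castSucc) (Fin.last m))
              (coins (Fin.last m)).1 + (coins (Fin.last m)).2)) := by
      rw [← innerStep_eq hcl hC hd hr D hxt (innerIterate_mem hcl hr D hxt _ _), ← hcast]
      exact Fin.induction_succ _ _ _
    rw [run, ih, transition, Fin.sum_univ_castSucc, ← Fin.succ_last, hlast]
    simp only [Fin.succ_castSucc, hcast]

theorem epoch_eq (hcl : IsClosed C) (hC : Convex ℝ C)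
    (hd : ∀ z, ∀ x ∈ C, DifferentiableAt ℝ (fun w => f w z) x)
    (hr : ConvexOn ℝ Set.univ fun w => η * r w) (D : Fin n → Z)
    {xt : EuclideanSpace ℝ (Fin p)} (hxt : xt ∈ C) (m : ℕ)
    (coins : Fin m → Fin n × EuclideanSpace ℝ (Fin p)) :
    epoch C f r η D m xt coins =
      modelEpoch (prox C fun w => η * r w) (projGrad C f D) η m xt coins := by
  rw [modelEpoch, run_transition_eq hcl hC hd hr D hxt, epoch]

theorem svrg_eq (hcl : IsClosed C) (hC : Convex ℝ C)
    (hd : ∀ z, ∀ x ∈ C, DifferentiableAt ℝ (fun w => f w z) x)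
    (hr : ConvexOn ℝ Set.univ fun w => η * r w) (D : Fin n → Z)
    {x0 : EuclideanSpace ℝ (Fin p)} (hx0 : x0 ∈ C) (T : ℕ) {m : ℕ} (hm : 0 < m)
    (ω : Fin T → Fin m → Fin n × EuclideanSpace ℝ (Fin p)) :
    svrg C f r x0 T m η D ω =
      run (modelEpoch (prox C fun w => η * r w) (projGrad C f D) η m) x0 T ω := by
  rw [svrg, induction_last (epoch C f r η D m)]
  exact (run_congr_of_mem (fun s hs c =>
    ⟨epoch_eq hcl hC hd hr D hs m c, epoch_mem hcl hC hr D hs hm c⟩) hx0 T ω).1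

end Identification

/-! ### From the dual Rényi bound to `(ε, δ)`. -/

section Privacy

/-- On an indicator the bound reads `μ S ≤ e^a (ν S)^(k/(k+1))`. Weighted AM-GM splits the right
side into at most `e^ε ν S` plus `exp ((k+1) a - ε k)`, and the latter is at most `δ`. -/
theorem HolderDominated.measure_le {X : Type*} [MeasurableSpace X] {k : ℕ} (hk : 0 < k)
    {a ε δ : ℝ} {μ ν : Measure X} [IsFiniteMeasure ν] (hδ : 0 < δ)
    (h : HolderDominated k (ENNReal.ofReal (Real.exp a)) μ ν)
    (ha : ((k : ℝ) + 1) * a + Real.log (1 / δ) ≤ ε * k) {S : Set X} (hS : MeasurableSet S) :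
    μ S ≤ ENNReal.ofReal (Real.exp ε) * ν S + ENNReal.ofReal δ := by
  have hk' : (0 : ℝ) < k := by exact_mod_cast hk
  have h1 := h (S.indicator 1) (measurable_one.indicator hS)
  have e : ∀ x, S.indicator (1 : X → ℝ≥0∞) x ^ (((k : ℝ) + 1) / k) = S.indicator 1 x := by
    intro x
    have : (0 : ℝ) < ((k : ℝ) + 1) / k := by positivity
    by_cases hx : x ∈ S
    · simp [hx]
    · simp [hx, this]
  simp only [e] at h1
  rw [lintegral_indicator_one hS, lintegral_indicator_one hS] at h1
  refine h1.trans ?_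
  rw [← ENNReal.ofReal_toReal (measure_ne_top ν S)]
  set x := (ν S).toReal
  have hx : 0 ≤ x := ENNReal.toReal_nonneg
  rw [ENNReal.ofReal_rpow_of_nonneg hx (by positivity), ← ENNReal.ofReal_mul (Real.exp_pos _).le,
    ← ENNReal.ofReal_mul (Real.exp_pos _).le, ← ENNReal.ofReal_add (by positivity) hδ.le]
  refine ENNReal.ofReal_le_ofReal ?_
  set θ : ℝ := (k : ℝ) / (k + 1) with hθ
  have hY : Real.exp ((k + 1) * a - ε * k) ≤ δ := by
    calc _ ≤ Real.exp (- Real.log (1 / δ)) := Real.exp_le_exp.2 (by linarith)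
      _ = δ := by rw [one_div, Real.log_inv, neg_neg, Real.exp_log hδ]
  have hw : 1 / ((k : ℝ) + 1) ≤ 1 := by
    rw [div_le_one (by positivity)]
    linarith
  have hθ1 : θ ≤ 1 := by
    rw [hθ, div_le_one (by positivity)]
    linarith
  have hm := Real.geom_mean_le_arith_mean2_weighted (w₁ := θ) (w₂ := 1 / ((k : ℝ) + 1))
    (p₁ := Real.exp ε * x) (p₂ := Real.exp ((k + 1) * a - ε * k)) (by positivity) (by positivity)
    (by positivity) (Real.exp_pos _).le (by rw [hθ]; field_simp)
  rw [Real.mul_rpow (Real.exp_pos _).le hx, ← Real.exp_mul, ← Real.exp_mul] at hm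
  have e2 : Real.exp (ε * θ) * x ^ θ * Real.exp (((k + 1) * a - ε * k) * (1 / (k + 1))) =
      Real.exp a * x ^ θ := by
    rw [mul_right_comm, ← Real.exp_add]
    congr 2
    rw [hθ]
    field_simp
    ring
  rw [e2] at hm
  refine hm.trans ?_
  have h3 : θ * (Real.exp ε * x) ≤ 1 * (Real.exp ε * x) := by gcongr
  have h4 : 1 / ((k : ℝ) + 1) * Real.exp ((k + 1) * a - ε * k) ≤ 1 * δ := by gcongr
  linarith

/-- An order at which the Rényi bounds for the whole run give `(ε, δ)`-differential privacy. -/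
theorem exists_order {N σ G n ε l : ℝ} (hN : 0 < N) (hG : 0 < G) (hn : 0 < n)
    (hε : 0 < ε) (hl : ε ≤ l)
    (hε1 : ε ≤ 12 * stepConst / 7168 * (N / n ^ 2))
    (hσ : σ ^ 2 = 12 * stepConst * (G ^ 2 * N * l / (n ^ 2 * ε ^ 2))) :
    ∃ k : ℕ, 0 < k ∧ (2 * (k : ℝ) + 1) * (16 * G ^ 2) ≤ σ ^ 2 / 64 ∧
      ((k : ℝ) + 1) * (N * (stepConst * k * G ^ 2 / (n ^ 2 * σ ^ 2))) + l ≤ ε * k := by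
  have hc := stepConst_pos
  have hl0 : 0 < l := hε.trans_le hl
  -- Half of `ε k` pays for `l`. The choice of `σ` keeps the total exponent below `ε/4`, so the
  -- other half covers `(k+1) ε/4`.
  set k := ⌈2 * l / ε⌉₊ with hk
  have hk0 : 0 < k := Nat.ceil_pos.2 (by positivity)
  have hk1 : (1 : ℝ) ≤ k := by exact_mod_cast hk0
  have hlow : 2 * l ≤ k * ε := by
    have := Nat.le_ceil (2 * l / ε)
    rwa [div_le_iff₀ hε] at this
  have hup : k * ε ≤ 3 * l := by
    have := (Nat.ceil_lt_add_one (by positivity : 0 ≤ 2 * l / ε)).le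
    calc (k : ℝ) * ε ≤ (2 * l / ε + 1) * ε := by gcongr
      _ = 2 * l + ε := by field_simp
      _ ≤ 3 * l := by linarith
  refine ⟨k, hk0, ?_, ?_⟩
  -- The constant 7168 is `7 * 16 * 64`: 7 from this bound, 16 and 64 from the smallness condition
  -- on the order.
  · have h7 : (2 * (k : ℝ) + 1) * ε ≤ 7 * l := by nlinarith
    have h8 : ε * (7168 * n ^ 2) ≤ 12 * stepConst * N := by
      have e : 12 * stepConst / 7168 * (N / n ^ 2) = 12 * stepConst * N / (7168 * n ^ 2) := by
        field_simp
      rwa [e, le_div_iff₀ (by positivity)] at hε1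
    rw [hσ, mul_div_assoc', div_div, le_div_iff₀ (by positivity)]
    calc (2 * (k : ℝ) + 1) * (16 * G ^ 2) * (n ^ 2 * ε ^ 2 * 64)
        = ((2 * k + 1) * ε) * (1024 * G ^ 2 * n ^ 2 * ε) := by ring
      _ ≤ (7 * l) * (1024 * G ^ 2 * n ^ 2 * ε) := by gcongr
      _ = (l * G ^ 2) * (ε * (7168 * n ^ 2)) := by ring
      _ ≤ (l * G ^ 2) * (12 * stepConst * N) := by gcongr
      _ = _ := by ring
  · have ha : N * (stepConst * k * G ^ 2 / (n ^ 2 * σ ^ 2)) = k * ε * ε / (12 * l) := by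
      rw [hσ]
      field_simp
    have ha4 : k * ε * ε / (12 * l) ≤ ε / 4 := by
      rw [div_le_div_iff₀ (by positivity) (by norm_num)]
      nlinarith
    rw [ha]
    calc _ ≤ ((k : ℝ) + 1) * (ε / 4) + l := by gcongr
      _ ≤ _ := by nlinarith

end Privacy

end DPSVRG
end

/-! ### Assembly of the theorem. -/

theorem theorem4p1 :
    ∃ c₁ c : ℝ, 0 < c₁ ∧ 0 < c ∧
      ∀ (Z : Type*) (p n T m : ℕ) (C : Set (EuclideanSpace ℝ (Fin p)))
        (f : EuclideanSpace ℝ (Fin p) → Z → ℝ) (r : EuclideanSpace ℝ (Fin p) → ℝ)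
        (x0 : EuclideanSpace ℝ (Fin p)) (G L : NNReal) (μ η σ ε δ : ℝ),
        0 < n → 0 < T → 0 < m →
        -- the domain and the starting point
        IsClosed C → Convex ℝ C → x0 ∈ C →
        -- the loss is differentiable, convex, `G`-Lipschitz and `L`-smooth over `C`
        (∀ z, ∀ x ∈ C, DifferentiableAt ℝ (fun w => f w z) x) →
        (∀ z, ConvexOn ℝ C (fun w => f w z)) →
        (∀ z, LipschitzOnWith G (fun w => f w z) C) →
        (∀ z, LipschitzOnWith L (fun x => gradient (fun w => f w z) x) C) →
        -- the regularizer is convex and the regularized risk is `μ`-strongly convex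
        ConvexOn ℝ Set.univ r →
        0 < μ → (∀ D : Fin n → Z, StrongConvexOn C μ (fun x => DPSVRG.empRisk f D x + r x)) →
        0 < η →
        -- the privacy parameters and the noise level
        0 < ε → 0 < δ → ε ≤ Real.log (1 / δ) →
        ε ≤ c₁ * ((T : ℝ) * m / (n : ℝ) ^ 2) →
        0 ≤ σ →
        σ ^ 2 = c * ((G : ℝ) ^ 2 * T * m * Real.log (1 / δ) / ((n : ℝ) ^ 2 * ε ^ 2)) →
        DPSVRG.IsDifferentiallyPrivate (DPSVRG.coinLaw p n T m σ)
          (DPSVRG.svrg C f r x0 T m η) ε δ := by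
  have hc := DPSVRG.stepConst_pos
  refine ⟨12 * DPSVRG.stepConst / 7168, 12 * DPSVRG.stepConst, by positivity, by positivity, ?_⟩
  intro Z p n T m C f r x0 G L μ η σ ε δ hn hT hm hcl hC hx0 hd _ hG hL hr _ _ hη hε hδ hl hε1
    hσ0 hσ D D' ⟨j, hj⟩ S hS
  have hr' : ConvexOn ℝ Set.univ fun w => η * r w := hr.smul hη.le
  have hgc : ∀ z, ContinuousOn (fun x => gradient (fun w => f w z) x) C := fun z =>
    (hL z).continuousOn
  simp only [DPSVRG.svrg_eq hcl hC hd hr' _ hx0 T hm]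
  -- For `G = 0` the prescribed noise is zero and no Gaussian bound applies, but the projected
  -- gradients vanish and the output does not depend on the data.
  rcases eq_or_ne G 0 with hG0 | hG0
  · have hzero : ∀ D : Fin n → Z, DPSVRG.projGrad C f D = fun _ _ => 0 := by
      intro D
      funext i x
      have := DPSVRG.norm_projGrad_le hC hd hG hgc D i x
      rw [hG0, NNReal.coe_zero] at this
      exact norm_le_zero_iff.1 this
    rw [hzero D, hzero D']
    refine le_add_right ?_
    refine le_mul_of_one_le_left (zero_le) ?_
    rw [← ENNReal.ofReal_one]
    exact ENNReal.ofReal_le_ofReal (Real.one_le_exp hε.le)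
  · have hGpos : (0 : ℝ) < G := by
      have := pos_iff_ne_zero.2 hG0
      exact_mod_cast this
    have hn' : (0 : ℝ) < n := by exact_mod_cast hn
    have hT' : (0 : ℝ) < T := by exact_mod_cast hT
    have hm' : (0 : ℝ) < m := by exact_mod_cast hm
    have hlpos : 0 < Real.log (1 / δ) := hε.trans_le hl
    rw [mul_assoc _ (T : ℝ)] at hσ
    have hσpos : 0 < σ := by
      refine lt_of_le_of_ne hσ0 fun h => ?_
      rw [← h, zero_pow two_ne_zero] at hσ
      have : 0 < 12 * DPSVRG.stepConst *
        ((G : ℝ) ^ 2 * (T * m) * Real.log (1 / δ) / ((n : ℝ) ^ 2 * ε ^ 2)) := by positivity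
      linarith
    obtain ⟨k, hk, hks, hka⟩ := DPSVRG.exists_order (N := T * m) (by positivity) hGpos hn' hε hl
      hε1 hσ
    have hP : Measurable (DPSVRG.prox C fun w => η * r w) :=
      (DPSVRG.lipschitzWith_prox hcl hC ⟨x0, hx0⟩ hr').continuous.measurable
    have hmeas := fun D : Fin n → Z => DPSVRG.measurable_projGrad hcl hgc D
    have h := DPSVRG.holderDominated_model hk hσpos hGpos hks j hP (η := η) (hmeas D) (hmeas D')
      (DPSVRG.norm_projGrad_le hC hd hG hgc D) (DPSVRG.norm_projGrad_le hC hd hG hgc D')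
      (fun i hi => by rw [DPSVRG.projGrad, DPSVRG.projGrad, hj i hi]) T m x0
    rw [← pow_mul, ← ENNReal.ofReal_pow (Real.exp_pos _).le, ← Real.exp_nat_mul, Nat.cast_mul,
      mul_comm (m : ℝ)] at h
    have hrun := fun D : Fin n → Z => DPSVRG.measurable_run_right
      (DPSVRG.measurable_modelEpoch (η := η) hP (hmeas D) m) x0 T
    have : Nonempty (Fin n) := ⟨j⟩
    have : IsProbabilityMeasure (DPSVRG.coinLaw p n T m σ) := by
      unfold DPSVRG.coinLaw
      infer_instance
    have hfin := h.measure_le hk hδ hka hS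
    rwa [Measure.map_apply (hrun D) hS, Measure.map_apply (hrun D') hS] at hfin
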